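/- Let $E=(E^0,E^1,r,s)$ be a directed graph with countable sets $E^0$ of vertices and $E^1$ of edges and with range and source maps $r,s:E^1\to E^0$. Suppose that $E$ is locally finite (every vertex emits and receives only finitely many edges) and has no sources (every vertex receives an edge). Let $A=C^*(E)$ be the graph $C^*$-algebra, that is, the universal $C^*$-algebra generated by mutually orthogonal projections $p_v$ ($v\in E^0$) and partial isometries $S_e$ ($e\in E^1$) with $S_e^*S_e=p_{r(e)}$ for all $e$ and $p_v=\sum_{s(e)=v}S_eS_e^*$ whenever $v$ emits an edge. Let $\gamma$ be the gauge action of the circle on $A$, given by $\gamma_z(S_e)=zS_e$ and $\gamma_z(p_v)=p_v$, let $F=C^*(E)^\gamma$ be its fixed point algebra and $\Phi(a)=\frac1{2\pi}\int_0^{2\pi}\gamma_{e^{i\theta}}(a)\,d\theta$ the expectation of $A$ onto $F$. Let $X$ be the right $C^*$-$F$-module obtained by completing $A$, with right multiplication by $F$ and the inner product $(a|b)=\Phi(a^*b)$, in the norm $\|x\|^2=\|\Phi(x^*x)\|$; left multiplication makes $A$ act on $X$. The gauge action extends to $X$; for $k\in\mathbf Z$ put $\Phi_k(x)=\frac1{2\pi}\int_0^{2\pi}e^{-ik\theta}\gamma_{e^{i\theta}}(x)\,d\theta$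 and $x_k=\Phi_k(x)$, and let $\mathcal D$ be the generator of the gauge action on $X$, i.e. $\mathcal Dx=\sum_{k\in\mathbf Z}kx_k$ with domain the set of all $x\in X$ for which $\sum_{k\in\mathbf Z}k^2(x_k|x_k)$ converges in norm. Then $V=\mathcal D(1+\mathcal D^2)^{-1/2}$ is a well-defined bounded operator on $X$ (where $(1+\mathcal D^2)^{-1/2}$ is the positive bounded operator whose square is the inverse of $1+\mathcal D^2$), and $(X,V)$ is an odd Kasparov $A$-$F$-module: $X$ is countably generated, $A$ acts on $X$ through a $*$-homomorphism to the adjointable operators, $V$ is adjointable, and for every $a\in A$ the operators $a(V-V^*)$, $a(V^2-1)$ and $[V,a]$ are compact endomorphisms of $X$, i.e. lie in the norm closure of the linear span of the operators $\Theta_{x,y}z=x(y|z)$. Consequently $(X,V)$ defines an element of $KK^1(A,F)$, the homotopy classes of odd Kasparov $A$-$F$-modules. -/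

import Mathlib

universe u v w

namespace GraphKK

open UniformSpace
open scoped ENNReal

/-! ### Right Hilbert modules over a (possibly non-unital) C⋆-algebra -/

/-- A right pre-Hilbert module over the C⋆-algebra `B`: a right `B`-module `M` with a `B`-valued
positive semidefinite inner product, linear in the second variable.  In a C⋆-algebra the positive
elements are exactly those of the form `b⋆ b`. -/
class PreHilbertModule (B : Type v) [NonUnitalCStarAlgebra B] (M : Type w) [AddCommGroup M]
    [Module ℂ M] extends Inner B M where
  /-- the right action `x · b` -/
  ract : M → B → M
  ract_add_left : ∀ x y b, ract (x + y) b = ract x b + ract y b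
  ract_add_right : ∀ x b c, ract x (b + c) = ract x b + ract x c
  ract_mul : ∀ x b c, ract x (b * c) = ract (ract x b) c
  ract_smul_left : ∀ (z : ℂ) x b, ract (z • x) b = z • ract x b
  ract_smul_right : ∀ (z : ℂ) x b, ract x (z • b) = z • ract x b
  inner_add_right : ∀ x y z : M, inner x (y + z) = inner x y + inner x z
  inner_smul_right : ∀ (c : ℂ) (x y : M), inner x (c • y) = c • inner x y
  inner_ract_right : ∀ (x y : M) (b : B), inner x (ract y b) = inner x y * b
  star_inner : ∀ x y : M, star (inner x y) = inner y x
  inner_self_nonneg : ∀ x : M, ∃ b : B, inner x x = star b * b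

/-- A right Hilbert module over the C⋆-algebra `B` (a right `C⋆`-`B`-module): a right
pre-Hilbert module which is complete in the norm `‖x‖² = ‖⟨x, x⟩‖`. -/
class HilbertModule (B : Type v) [NonUnitalCStarAlgebra B] (X : Type w) [NormedAddCommGroup X]
    [NormedSpace ℂ X] extends PreHilbertModule B X where
  complete : CompleteSpace X
  norm_sq_eq : ∀ x : X, ‖x‖ ^ 2 = ‖inner x x‖

section PreHilbert

variable {B : Type v} [NonUnitalCStarAlgebra B] {M : Type w} [AddCommGroup M] [Module ℂ M]
  [PreHilbertModule B M]

namespace PreHilbertModule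

lemma inner_add_left (x y z : M) : inner B (x + y) z = inner B x z + inner B y z := by
  rw [← star_inner z, inner_add_right, star_add, star_inner, star_inner]

lemma inner_smul_left (c : ℂ) (x y : M) : inner B (c • x) y = star c • inner B x y := by
  rw [← star_inner y, inner_smul_right, star_smul, star_inner]

lemma inner_ract_left (x y : M) (b : B) : inner B (ract x b) y = star b * inner B x y := by
  rw [← star_inner y, inner_ract_right, star_mul, star_inner]

lemma inner_zero_right (x : M) : inner B x (0 : M) = 0 := by
  simpa using inner_smul_right (B := B) 0 x 0

lemma inner_neg_right (x y : M) : inner B x (-y) = - inner B x y := by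
  simpa using inner_smul_right (B := B) (-1) x y

lemma inner_sub_right (x y z : M) : inner B x (y - z) = inner B x y - inner B x z := by
  rw [sub_eq_add_neg, inner_add_right, inner_neg_right, ← sub_eq_add_neg]

lemma inner_sub_left (x y z : M) : inner B (x - y) z = inner B x z - inner B y z := by
  rw [← star_inner z, inner_sub_right, star_sub, star_inner, star_inner]

attribute [local instance] CStarAlgebra.spectralOrder CStarAlgebra.spectralOrderedRing

lemma inner_self_nonneg' (x : M) : 0 ≤ inner B x x := by
  obtain ⟨b, hb⟩ := inner_self_nonneg (B := B) x
  exact hb ▸ star_mul_self_nonneg b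

/-- The Cauchy–Schwarz inequality. -/
lemma norm_inner_sq_le (x y : M) :
    ‖inner B x y‖ ^ 2 ≤ ‖inner B x x‖ * ‖inner B y y‖ := by
  set p := ‖inner B x x‖ with hp
  have key : ∀ c : ℝ, 0 < c → p ≤ c → ‖inner B x y‖ ^ 2 ≤ c * ‖inner B y y‖ := by
    intro c hc hpc
    set t := inner B x y with ht
    have hyx : inner B y x = star t := (star_inner x y).symm
    have h1 : (0 : B) ≤ inner B (ract x t - (c : ℂ) • y) (ract x t - (c : ℂ) • y) :=
      inner_self_nonneg' _
    have h2 : inner B (ract x t - (c : ℂ) • y) (ract x t - (c : ℂ) • y)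
        = star t * inner B x x * t - (c : ℂ) • (star t * t) - (c : ℂ) • (star t * t)
          + (c : ℂ) • (c : ℂ) • inner B y y := by
      simp only [inner_sub_right, inner_sub_left, inner_ract_left, inner_ract_right,
        inner_smul_left, inner_smul_right, hyx, ← ht, smul_sub]
      simp only [RCLike.star_def, Complex.conj_ofReal, sub_mul, smul_mul_assoc, mul_assoc]
      abel
    have h3 : star t * inner B x x * t ≤ p • (star t * t) :=
      CStarAlgebra.star_left_conjugate_le_norm_smul (.of_nonneg (inner_self_nonneg' x))
    have h4 : p • (star t * t) ≤ c • (star t * t) :=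
      smul_le_smul_of_nonneg_right hpc (star_mul_self_nonneg t)
    have h5 : c • (star t * t) ≤ c • (c • inner B y y) := by
      rw [h2] at h1
      have h6 := h3.trans h4
      simp only [Complex.coe_smul] at h1
      rw [← sub_nonneg]
      have h7 := add_nonneg h1 (sub_nonneg.2 h6)
      convert h7 using 1
      abel
    have h8 : star t * t ≤ c • inner B y y := (smul_le_smul_iff_of_pos_left hc).1 h5
    calc ‖t‖ ^ 2 = ‖star t * t‖ := by rw [CStarRing.norm_star_mul_self, pow_two]
      _ ≤ ‖c • inner B y y‖ :=
        CStarAlgebra.norm_le_norm_of_nonneg_of_le (star_mul_self_nonneg t) h8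
      _ = c * ‖inner B y y‖ := by rw [norm_smul, Real.norm_of_nonneg hc.le]
  refine le_of_forall_pos_le_add fun ε hε => ?_
  have hd : 0 < ε / (‖inner B y y‖ + 1) := by positivity
  refine (key (p + ε / (‖inner B y y‖ + 1)) (by positivity) (by linarith)).trans ?_
  rw [add_mul]
  gcongr
  rw [div_mul_eq_mul_div, div_le_iff₀ (by positivity)]
  nlinarith [norm_nonneg (inner B y y)]

/-- `M` regarded as a seminormed space through `‖x‖ = ‖⟨x, x⟩‖^{1/2}`. -/
def Pre (B : Type v) [NonUnitalCStarAlgebra B] (M : Type w) [AddCommGroup M] [Module ℂ M]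
    [PreHilbertModule B M] : Type w := M

instance : AddCommGroup (Pre B M) := inferInstanceAs (AddCommGroup M)
instance : Module ℂ (Pre B M) := inferInstanceAs (Module ℂ M)
instance : PreHilbertModule B (Pre B M) := inferInstanceAs (PreHilbertModule B M)

/-- The identity map from `M` to `Pre B M`. -/
def Pre.of : M ≃ₗ[ℂ] Pre B M := LinearEquiv.refl ℂ M

lemma Pre.inner_of (x y : M) : inner B (Pre.of x : Pre B M) (Pre.of y) = inner B x y := rfl

noncomputable instance : Norm (Pre B M) := ⟨fun x => √‖inner B x x‖⟩

lemma pre_norm_def (x : Pre B M) : ‖x‖ = √‖inner B x x‖ := rfl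

lemma pre_norm_sq (x : Pre B M) : ‖x‖ ^ 2 = ‖inner B x x‖ := by
  rw [pre_norm_def, Real.sq_sqrt (norm_nonneg _)]

lemma pre_norm_nonneg (x : Pre B M) : 0 ≤ ‖x‖ := Real.sqrt_nonneg _

lemma pre_norm_inner_le (x y : Pre B M) : ‖inner B x y‖ ≤ ‖x‖ * ‖y‖ := by
  refine abs_le_of_sq_le_sq' ?_ (mul_nonneg (pre_norm_nonneg x) (pre_norm_nonneg y)) |>.2
  rw [mul_pow, pre_norm_sq, pre_norm_sq]
  exact norm_inner_sq_le x y

lemma pre_core : SeminormedSpace.Core ℂ (Pre B M) where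
  norm_nonneg := pre_norm_nonneg
  norm_smul c x := by
    rw [pre_norm_def, inner_smul_right, inner_smul_left, norm_smul, norm_smul, ← mul_assoc,
      norm_star, Real.sqrt_mul (by positivity), Real.sqrt_mul_self (norm_nonneg _), pre_norm_def]
  norm_triangle x y := by
    refine abs_le_of_sq_le_sq' ?_ (add_nonneg (pre_norm_nonneg x) (pre_norm_nonneg y)) |>.2
    have h1 := pre_norm_inner_le x y
    have h2 := pre_norm_inner_le y x
    have h3 : ‖inner B (x + y) (x + y)‖ ≤
        ‖inner B x x‖ + ‖inner B x y‖ + (‖inner B y x‖ + ‖inner B y y‖) := by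
      rw [inner_add_left, inner_add_right, inner_add_right]
      exact (norm_add_le _ _).trans (add_le_add (norm_add_le _ _) (norm_add_le _ _))
    rw [← pre_norm_sq, ← pre_norm_sq, ← pre_norm_sq] at h3
    nlinarith

noncomputable instance : SeminormedAddCommGroup (Pre B M) := .ofCore pre_core
noncomputable instance : NormedSpace ℂ (Pre B M) where
  norm_smul_le c x := (pre_core.norm_smul c x).le

lemma pre_continuous_inner :
    Continuous (Function.uncurry (inner B : Pre B M → Pre B M → B)) := by
  let f : Pre B M →ₗ⋆[ℂ] Pre B M →ₗ[ℂ] B :=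
    LinearMap.mk₂'ₛₗ (starRingEnd ℂ) (RingHom.id ℂ) (fun x y => inner B x y)
      inner_add_left inner_smul_left inner_add_right inner_smul_right
  let g := (f.mkContinuous₂ 1 (fun x y => by simpa [f] using pre_norm_inner_le x y))
  change Continuous fun p : Pre B M × Pre B M => g p.1 p.2
  fun_prop

lemma pre_norm_ract_le (x : Pre B M) (b : B) : ‖ract x b‖ ≤ ‖b‖ * ‖x‖ := by
  refine abs_le_of_sq_le_sq' ?_ (mul_nonneg (norm_nonneg _) (pre_norm_nonneg x)) |>.2
  rw [pre_norm_sq, inner_ract_left, inner_ract_right, mul_pow, pre_norm_sq]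
  calc _ ≤ ‖star b‖ * (‖inner B x x‖ * ‖b‖) :=
        (norm_mul_le _ _).trans (by gcongr; exact norm_mul_le _ _)
    _ = _ := by rw [norm_star]; ring

end PreHilbertModule

end PreHilbert

/-- The extension of a bounded linear operator to the completions. -/
noncomputable def complMap {M N : Type*} [SeminormedAddCommGroup M] [NormedSpace ℂ M]
    [SeminormedAddCommGroup N] [NormedSpace ℂ N] (T : M →L[ℂ] N) :
    Completion M →L[ℂ] Completion N :=
  ((Completion.toComplL : N →L[ℂ] Completion N).comp T).extend
    (Completion.toComplL : M →L[ℂ] Completion M)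

lemma complMap_coe {M N : Type*} [SeminormedAddCommGroup M] [NormedSpace ℂ M]
    [SeminormedAddCommGroup N] [NormedSpace ℂ N] (T : M →L[ℂ] N) (x : M) :
    complMap T (x : Completion M) = (T x : Completion N) :=
  ContinuousLinearMap.extend_eq _ Completion.denseRange_coe
    (Completion.isUniformInducing_coe M) x

section Completion

open PreHilbertModule

variable (B : Type v) [NonUnitalCStarAlgebra B] (M : Type w) [AddCommGroup M] [Module ℂ M]
  [PreHilbertModule B M]

/-- The Hilbert `B`-module obtained by completing a pre-Hilbert `B`-module `M` in the norm
`‖x‖ = ‖⟨x, x⟩‖^{1/2}`. -/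
abbrev HilbertCompletion : Type w := Completion (Pre B M)

variable {B M}

/-- Right multiplication by `b`, as a bounded operator. -/
noncomputable def ractCLM (b : B) : Pre B M →L[ℂ] Pre B M :=
  LinearMap.mkContinuous
    { toFun := fun x => ract x b
      map_add' := fun x y => ract_add_left x y b
      map_smul' := fun c x => ract_smul_left c x b } ‖b‖ (fun x => pre_norm_ract_le x b)

lemma compl_inner_coe (x y : Pre B M) :
    inner B (x : HilbertCompletion B M) (y : HilbertCompletion B M) = inner B x y :=
  (Completion.isDenseInducing_coe.prodMap Completion.isDenseInducing_coe).extend_eq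
    pre_continuous_inner (x, y)

lemma compl_continuous_inner :
    Continuous (Function.uncurry (inner B (E := HilbertCompletion B M))) := by
  let inner' : Pre B M →+ Pre B M →+ B :=
    AddMonoidHom.mk' (fun x => AddMonoidHom.mk' (fun y => inner B x y) (inner_add_right x))
      (fun x y => by ext z; exact inner_add_left x y z)
  have : Continuous fun p : Pre B M × Pre B M => inner' p.1 p.2 := pre_continuous_inner
  exact (Completion.isDenseInducing_toCompl (Pre B M)).extend_Z_bilin
    (Completion.isDenseInducing_toCompl (Pre B M)) this

lemma Continuous.compl_inner {α : Type*} [TopologicalSpace α] {f g : α → HilbertCompletion B M}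
    (hf : Continuous f) (hg : Continuous g) : Continuous (fun x => inner B (f x) (g x)) :=
  compl_continuous_inner.comp (hf.prodMk hg)

section

attribute [local instance] CStarAlgebra.spectralOrder CStarAlgebra.spectralOrderedRing

lemma exists_eq_star_mul_self_iff (b : B) : (∃ c, b = star c * c) ↔ 0 ≤ b := by
  constructor
  · rintro ⟨c, rfl⟩
    exact star_mul_self_nonneg c
  · intro h
    exact CStarAlgebra.nonneg_iff_eq_star_mul_self.1 h

lemma isClosed_pos : IsClosed {b : B | ∃ c, b = star c * c} := by
  simp only [exists_eq_star_mul_self_iff]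
  exact CStarAlgebra.isClosed_nonneg

end

lemma compl_inner_add_right (x y z : HilbertCompletion B M) :
    inner B x (y + z) = inner B x y + inner B x z := by
  refine Completion.induction_on₃ x y z (isClosed_eq ?_ ?_) fun a b c => ?_
  · exact Continuous.compl_inner continuous_fst (continuous_snd.fst.add continuous_snd.snd)
  · exact (Continuous.compl_inner continuous_fst continuous_snd.fst).add
      (Continuous.compl_inner continuous_fst continuous_snd.snd)
  · rw [← Completion.coe_add, compl_inner_coe, compl_inner_coe, compl_inner_coe,
      PreHilbertModule.inner_add_right]

lemma compl_inner_smul_right (c : ℂ) (x y : HilbertCompletion B M) :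
    inner B x (c • y) = c • inner B x y := by
  have h1 : Continuous fun p : HilbertCompletion B M × HilbertCompletion B M =>
      inner B p.1 (c • p.2) :=
    Continuous.compl_inner continuous_fst
      ((continuous_const_smul c : Continuous fun y : HilbertCompletion B M => c • y).comp
        continuous_snd)
  have h2 : Continuous fun p : HilbertCompletion B M × HilbertCompletion B M =>
      c • inner B p.1 p.2 :=
    (continuous_const_smul c : Continuous fun b : B => c • b).comp
      (Continuous.compl_inner continuous_fst continuous_snd)
  refine Completion.induction_on₂ x y (isClosed_eq h1 h2) fun a b => ?_
  rw [← Completion.coe_smul, compl_inner_coe, compl_inner_coe, PreHilbertModule.inner_smul_right]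

lemma compl_inner_ract_right (x y : HilbertCompletion B M) (b : B) :
    inner B x (complMap (ractCLM b) y) = inner B x y * b := by
  refine Completion.induction_on₂ x y (isClosed_eq ?_ ?_) fun a c => ?_
  · exact Continuous.compl_inner continuous_fst
      ((complMap (ractCLM b)).continuous.comp continuous_snd)
  · exact (Continuous.compl_inner continuous_fst continuous_snd).mul continuous_const
  · rw [complMap_coe, compl_inner_coe, compl_inner_coe]
    exact inner_ract_right a c b

lemma compl_star_inner (x y : HilbertCompletion B M) : star (inner B x y) = inner B y x := by
  refine Completion.induction_on₂ x y (isClosed_eq ?_ ?_) fun a b => ?_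
  · exact (Continuous.compl_inner continuous_fst continuous_snd).star
  · exact Continuous.compl_inner continuous_snd continuous_fst
  · rw [compl_inner_coe, compl_inner_coe, star_inner]

lemma compl_inner_self_nonneg (x : HilbertCompletion B M) : ∃ b : B, inner B x x = star b * b := by
  refine Completion.induction_on x ?_ fun a => ?_
  · exact isClosed_pos.preimage (Continuous.compl_inner continuous_id continuous_id)
  · rw [compl_inner_coe]
    exact inner_self_nonneg a

lemma compl_norm_sq_eq (x : HilbertCompletion B M) : ‖x‖ ^ 2 = ‖inner B x x‖ := by
  refine Completion.induction_on x (isClosed_eq (continuous_norm.pow 2) ?_) fun a => ?_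
  · exact (Continuous.compl_inner continuous_id continuous_id).norm
  · rw [compl_inner_coe, Completion.norm_coe, pre_norm_sq]

lemma compl_ract_add_right (x : HilbertCompletion B M) (b c : B) :
    complMap (ractCLM (b + c)) x = complMap (ractCLM b) x + complMap (ractCLM c) x := by
  refine Completion.induction_on x (isClosed_eq (ContinuousLinearMap.continuous _)
    ((ContinuousLinearMap.continuous _).add (ContinuousLinearMap.continuous _))) fun a => ?_
  rw [complMap_coe, complMap_coe, complMap_coe, ← Completion.coe_add]
  exact congrArg _ (ract_add_right (M := M) a b c)

lemma compl_ract_mul (x : HilbertCompletion B M) (b c : B) :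
    complMap (ractCLM (b * c)) x = complMap (ractCLM c) (complMap (ractCLM b) x) := by
  refine Completion.induction_on x (isClosed_eq (ContinuousLinearMap.continuous _)
    ((ContinuousLinearMap.continuous _).comp (ContinuousLinearMap.continuous _))) fun a => ?_
  rw [complMap_coe, complMap_coe, complMap_coe]
  exact congrArg _ (ract_mul (M := M) a b c)

lemma compl_ract_smul_right (z : ℂ) (x : HilbertCompletion B M) (b : B) :
    complMap (ractCLM (z • b)) x = z • complMap (ractCLM b) x := by
  refine Completion.induction_on x (isClosed_eq (ContinuousLinearMap.continuous _)
    (z • complMap (ractCLM b)).continuous) fun a => ?_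
  rw [complMap_coe, complMap_coe, ← Completion.coe_smul]
  exact congrArg _ (ract_smul_right (M := M) z a b)

noncomputable instance instHilbertCompletion : HilbertModule B (HilbertCompletion B M) where
  ract x b := complMap (ractCLM b) x
  ract_add_left x y _ := map_add _ x y
  ract_add_right := compl_ract_add_right
  ract_mul := compl_ract_mul
  ract_smul_left z x _ := map_smul _ z x
  ract_smul_right := compl_ract_smul_right
  inner_add_right := compl_inner_add_right
  inner_smul_right := compl_inner_smul_right
  inner_ract_right := compl_inner_ract_right
  star_inner := compl_star_inner
  inner_self_nonneg := compl_inner_self_nonneg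
  complete := inferInstance
  norm_sq_eq := compl_norm_sq_eq

end Completion

/-! ### Operators of the form `∑ k P_k` -/

section Diagonal

variable (B : Type v) [NonUnitalCStarAlgebra B] {Y : Type w} [NormedAddCommGroup Y]
  [NormedSpace ℂ Y] [HilbertModule B Y]

section

attribute [local instance] CStarAlgebra.spectralOrder CStarAlgebra.spectralOrderedRing

variable {B} in
lemma summable_of_nonneg_of_le {ι : Type*} {f g : ι → B}
    (hf : ∀ i, 0 ≤ f i) (hfg : ∀ i, f i ≤ g i) (hg : Summable g) : Summable f := by
  rw [summable_iff_vanishing_norm] at hg ⊢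
  intro ε hε
  obtain ⟨s, hs⟩ := hg ε hε
  refine ⟨s, fun t ht => lt_of_le_of_lt ?_ (hs t ht)⟩
  exact CStarAlgebra.norm_le_norm_of_nonneg_of_le (Finset.sum_nonneg fun i _ => hf i)
    (Finset.sum_le_sum fun i _ => hfg i)

lemma inner_add_self_le (x y : Y) :
    inner B (x + y) (x + y) ≤ (2 : ℝ) • inner B x x + (2 : ℝ) • inner B y y := by
  have h := PreHilbertModule.inner_self_nonneg' (B := B) (x - y)
  rw [← sub_nonneg]
  convert h using 1
  simp only [PreHilbertModule.inner_sub_left, PreHilbertModule.inner_sub_right,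
    PreHilbertModule.inner_add_left, PreHilbertModule.inner_add_right, two_smul]
  abel

lemma summable_weighted_add {P : ℤ → Y →ₗ[ℂ] Y} {x y : Y}
    (hx : Summable fun k : ℤ => ((k : ℝ) ^ 2) • inner B (P k x) (P k x))
    (hy : Summable fun k : ℤ => ((k : ℝ) ^ 2) • inner B (P k y) (P k y)) :
    Summable fun k : ℤ => ((k : ℝ) ^ 2) • inner B (P k (x + y)) (P k (x + y)) := by
  refine summable_of_nonneg_of_le (fun k => ?_) (fun k => ?_)
    ((hx.const_smul (2 : ℝ)).add (hy.const_smul (2 : ℝ)))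
  · exact smul_nonneg (by positivity) (PreHilbertModule.inner_self_nonneg' _)
  · rw [map_add, smul_comm (2 : ℝ), smul_comm (2 : ℝ), ← smul_add]
    exact smul_le_smul_of_nonneg_left (inner_add_self_le B _ _) (by positivity)

end

/-- The subspace of all `x` for which `∑ k² (x_k|x_k)`, with `x_k = P_k x`, converges. -/
def weightedDomain (P : ℤ → Y →ₗ[ℂ] Y) : Submodule ℂ Y where
  carrier := {x | Summable fun k : ℤ => ((k : ℝ) ^ 2) • inner B (P k x) (P k x)}
  add_mem' hx hy := summable_weighted_add B hx hy
  zero_mem' := by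
    have h : (fun k : ℤ => ((k : ℝ) ^ 2) • inner B (P k 0) (P k 0)) = fun _ => 0 := by
      funext k
      rw [map_zero, PreHilbertModule.inner_zero_right, smul_zero]
    change Summable _
    rw [h]
    exact summable_zero
  smul_mem' c x hx := by
    have hx' : Summable fun k : ℤ => ((k : ℝ) ^ 2) • inner B (P k x) (P k x) := hx
    change Summable _
    convert (hx'.const_smul (star c * c)) using 2 with k
    rw [map_smul, PreHilbertModule.inner_smul_left, PreHilbertModule.inner_smul_right,
      smul_smul (star c), smul_comm]

variable {B} in
lemma mem_weightedDomain {P : ℤ → Y →ₗ[ℂ] Y} {x : Y} : x ∈ weightedDomain B P ↔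
    Summable fun k : ℤ => ((k : ℝ) ^ 2) • inner B (P k x) (P k x) := Iff.rfl

lemma inner_sum_sum {f : ℤ → Y} (hf : ∀ k l, k ≠ l → inner B (f k) (f l) = 0) (s : Finset ℤ) :
    inner B (∑ k ∈ s, f k) (∑ k ∈ s, f k) = ∑ k ∈ s, inner B (f k) (f k) := by
  have hl : ∀ y, inner B (∑ k ∈ s, f k) y = ∑ k ∈ s, inner B (f k) y := fun y =>
    map_sum (AddMonoidHom.mk' (fun x => inner B x y)
      (fun a b => PreHilbertModule.inner_add_left a b y)) f s
  have hr : ∀ x, inner B x (∑ k ∈ s, f k) = ∑ k ∈ s, inner B x (f k) := fun x =>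
    map_sum (AddMonoidHom.mk' (fun y => inner B x y)
      (fun a b => PreHilbertModule.inner_add_right x a b)) f s
  rw [hl]
  refine Finset.sum_congr rfl fun k hk => ?_
  rw [hr, Finset.sum_eq_single k (fun l _ h => hf k l h.symm) (fun h => (h hk).elim)]

variable {B} in
lemma summable_of_mem_weightedDomain {P : ℤ → Y →ₗ[ℂ] Y}
    (hP : ∀ k l, k ≠ l → ∀ x y, inner B (P k x) (P l y) = 0) {x : Y}
    (hx : x ∈ weightedDomain B P) : Summable fun k : ℤ => (k : ℂ) • P k x := by
  have := HilbertModule.complete B (X := Y)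
  rw [mem_weightedDomain, summable_iff_vanishing_norm] at hx
  rw [summable_iff_vanishing_norm]
  intro ε hε
  obtain ⟨s, hs⟩ := hx (ε ^ 2) (by positivity)
  refine ⟨s, fun t ht => lt_of_pow_lt_pow_left₀ 2 hε.le ?_⟩
  refine lt_of_eq_of_lt ?_ (hs t ht)
  rw [HilbertModule.norm_sq_eq (B := B), inner_sum_sum]
  · congr 1
    refine Finset.sum_congr rfl fun k _ => ?_
    rw [PreHilbertModule.inner_smul_left, PreHilbertModule.inner_smul_right, smul_smul,
      ← Complex.coe_smul]
    congr 1
    simp [pow_two]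
  · intro k l hkl
    rw [PreHilbertModule.inner_smul_left, PreHilbertModule.inner_smul_right, hP k l hkl,
      smul_zero, smul_zero]

/-- For mutually orthogonal `P_k` the operator `x ↦ ∑ k P_k x`, with the domain of all `x` for
which `∑ k² (P_k x|P_k x)` converges. -/
noncomputable def weightedSum (P : ℤ → Y →ₗ[ℂ] Y)
    (hP : ∀ k l, k ≠ l → ∀ x y, inner B (P k x) (P l y) = 0) : Y →ₗ.[ℂ] Y where
  domain := weightedDomain B P
  toFun :=
    { toFun := fun x => ∑' k : ℤ, (k : ℂ) • P k (x : Y)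
      map_add' := fun x y => by
        rw [← (summable_of_mem_weightedDomain hP x.2).tsum_add
          (summable_of_mem_weightedDomain hP y.2)]
        refine tsum_congr fun k => ?_
        rw [Submodule.coe_add, map_add, smul_add]
      map_smul' := fun c x => by
        rw [RingHom.id_apply, ← (summable_of_mem_weightedDomain hP x.2).tsum_const_smul c]
        refine tsum_congr fun k => ?_
        rw [Submodule.coe_smul, map_smul, smul_comm] }

end Diagonal

/-! ### Circle actions, the conditional expectation and the associated Hilbert module -/

/-- A strongly continuous action of the circle group on a C⋆-algebra by ⋆-automorphisms. -/
structure CircleAction (A : Type v) [NonUnitalCStarAlgebra A] where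
  /-- the automorphism belonging to `z` -/
  act : Circle → (A →⋆ₙₐ[ℂ] A)
  act_one : ∀ a, act 1 a = a
  act_mul : ∀ z w a, act (z * w) a = act z (act w a)
  continuous_act : ∀ a, Continuous fun z => act z a

namespace CircleAction

variable {A : Type v} [NonUnitalCStarAlgebra A] (α : CircleAction A)

lemma act_inv_act (z : Circle) (a : A) : α.act z⁻¹ (α.act z a) = a := by
  rw [← α.act_mul, inv_mul_cancel, α.act_one]

lemma act_act_inv (z : Circle) (a : A) : α.act z (α.act z⁻¹ a) = a := by
  rw [← α.act_mul, mul_inv_cancel, α.act_one]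

lemma norm_act (z : Circle) (a : A) : ‖α.act z a‖ = ‖a‖ :=
  NonUnitalStarAlgHom.norm_map (α.act z) (Function.LeftInverse.injective (α.act_inv_act z)) a

/-- The automorphism belonging to `z`, as a bounded linear map. -/
noncomputable def actCLM (z : Circle) : A →L[ℂ] A :=
  LinearMap.mkContinuous
    { toFun := α.act z, map_add' := map_add (α.act z), map_smul' := map_smul (α.act z) } 1
    (fun a => by simpa using (α.norm_act z a).le)

/-- The fixed point algebra of the action. -/
def fixed : NonUnitalStarSubalgebra ℂ A where
  carrier := {a | ∀ z, α.act z a = a}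
  add_mem' ha hb z := by rw [map_add, ha, hb]
  zero_mem' z := map_zero _
  mul_mem' ha hb z := by rw [map_mul, ha, hb]
  smul_mem' c a ha z := by rw [map_smul, ha]
  star_mem' ha z := by rw [map_star, ha]

lemma mem_fixed {a : A} : a ∈ α.fixed ↔ ∀ z, α.act z a = a := Iff.rfl

instance isClosed_fixed : IsClosed (α.fixed : Set A) := by
  have : (α.fixed : Set A) = ⋂ z, {a | α.actCLM z a = a} := by
    ext a
    simp only [Set.mem_iInter]
    rfl
  rw [this]
  exact isClosed_iInter fun z => isClosed_eq (α.actCLM z).continuous continuous_id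

lemma continuous_act_exp (a : A) : Continuous fun θ : ℝ => α.act (Circle.exp θ) a :=
  (α.continuous_act a).comp Circle.exp.continuous

/-- The average `(1/2π) ∫ α_z(a) dθ`, `z = e^{iθ}`. -/
noncomputable def average (a : A) : A :=
  (2 * Real.pi)⁻¹ • ∫ θ in (0 : ℝ)..2 * Real.pi, α.act (Circle.exp θ) a

lemma act_average (w : Circle) (a : A) : α.act w (α.average a) = α.average a := by
  obtain ⟨t, rfl⟩ : ∃ t, Circle.exp t = w := ⟨Complex.arg w, Circle.exp_arg w⟩
  have h1 : α.act (Circle.exp t) (α.average a) = (2 * Real.pi)⁻¹ •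
      ∫ θ in (0 : ℝ)..2 * Real.pi, α.act (Circle.exp t) (α.act (Circle.exp θ) a) := by
    change α.actCLM (Circle.exp t) (α.average a) = _
    rw [average, ← Complex.coe_smul, map_smul, Complex.coe_smul]
    congr 1
    exact (ContinuousLinearMap.intervalIntegral_comp_comm _
      ((α.continuous_act_exp a).intervalIntegrable _ _)).symm
  rw [h1, average]
  congr 1
  have h2 : (fun θ : ℝ => α.act (Circle.exp t) (α.act (Circle.exp θ) a))
      = fun θ => (fun s => α.act (Circle.exp s) a) (θ + t) := by
    ext θ
    rw [← α.act_mul, ← Circle.exp_add, add_comm]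
  rw [h2, intervalIntegral.integral_comp_add_right (fun s => α.act (Circle.exp s) a)]
  have hper : Function.Periodic (fun s => α.act (Circle.exp s) a) (2 * Real.pi) := fun s => by
    simp only [Circle.exp_add, Circle.exp_two_pi, mul_one]
  have := hper.intervalIntegral_add_eq t 0
  rw [zero_add] at this
  rw [zero_add, add_comm (2 * Real.pi) t, this]

/-- The conditional expectation `Φ` onto the fixed point algebra. -/
noncomputable def expectation (a : A) : α.fixed := ⟨α.average a, fun z => α.act_average z a⟩

lemma average_add (a b : A) : α.average (a + b) = α.average a + α.average b := by
  simp only [average, map_add]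
  rw [intervalIntegral.integral_add ((α.continuous_act_exp a).intervalIntegrable _ _)
    ((α.continuous_act_exp b).intervalIntegrable _ _), smul_add]

lemma average_smul (c : ℂ) (a : A) : α.average (c • a) = c • α.average a := by
  simp only [average, map_smul]
  rw [intervalIntegral.integral_smul, smul_comm]

lemma average_mul_fixed (a : A) (b : α.fixed) : α.average (a * b) = α.average a * b := by
  have h : ∀ z, α.act z (b : A) = b := b.2
  simp only [average, map_mul, h]
  rw [smul_mul_assoc]
  congr 1
  exact ContinuousLinearMap.intervalIntegral_comp_comm ((ContinuousLinearMap.mul ℂ A).flip (b : A))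
    ((α.continuous_act_exp a).intervalIntegrable _ _)

lemma average_star (a : A) : α.average (star a) = star (α.average a) := by
  simp only [average, map_star, star_smul, star_trivial]
  congr 1
  exact ContinuousLinearMap.intervalIntegral_comp_comm
    ((starL' ℝ : A ≃L[ℝ] A) : A →L[ℝ] A) ((α.continuous_act_exp a).intervalIntegrable _ _)

lemma average_act (w : Circle) (a : A) : α.average (α.act w a) = α.average a := by
  obtain ⟨t, rfl⟩ : ∃ t, Circle.exp t = w := ⟨Complex.arg w, Circle.exp_arg w⟩
  rw [← α.act_average (Circle.exp t) a]
  change _ = α.actCLM (Circle.exp t) (α.average a)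
  rw [average, average, ← Complex.coe_smul, ← Complex.coe_smul, map_smul]
  congr 1
  rw [← ContinuousLinearMap.intervalIntegral_comp_comm _
      ((α.continuous_act_exp a).intervalIntegrable _ _)]
  congr 1
  ext θ
  change _ = α.act _ _
  rw [← α.act_mul, ← α.act_mul, mul_comm]

section

attribute [local instance] CStarAlgebra.spectralOrder CStarAlgebra.spectralOrderedRing

lemma average_nonneg {a : A} (ha : 0 ≤ a) : 0 ≤ α.average a := by
  refine smul_nonneg (by positivity) ?_
  rw [intervalIntegral.integral_of_le (by positivity)]
  refine MeasureTheory.integral_nonneg fun θ => ?_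
  obtain ⟨c, rfl⟩ := (exists_eq_star_mul_self_iff a).2 ha
  simp only [map_mul, map_star, Pi.zero_apply]
  exact star_mul_self_nonneg _

lemma average_mono {a b : A} (h : a ≤ b) : α.average a ≤ α.average b := by
  have h1 := α.average_nonneg (sub_nonneg.2 h)
  have h2 := α.average_add (b - a) a
  rw [sub_add_cancel] at h2
  rw [h2]
  exact le_add_of_nonneg_left h1

/-- A positive element of the fixed point algebra has its square root there. -/
lemma exists_fixed_sqrt (a : α.fixed) (ha : 0 ≤ (a : A)) : ∃ b : α.fixed, a = star b * b := by
  have h0 : 0 ≤ CFC.sqrt (a : A) := CFC.sqrt_nonneg _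
  have h1 : CFC.sqrt (a : A) * CFC.sqrt (a : A) = a := CFC.sqrt_mul_sqrt_self _ ha
  have h2 : CFC.sqrt (a : A) ∈ α.fixed := by
    intro z
    symm
    refine CFC.sqrt_unique ?_ ?_
    · rw [← map_mul, h1, a.2 z]
    · obtain ⟨c, hc⟩ := (exists_eq_star_mul_self_iff _).2 h0
      rw [hc, map_mul, map_star]
      exact star_mul_self_nonneg _
  refine ⟨⟨_, h2⟩, Subtype.ext ?_⟩
  change (a : A) = star (CFC.sqrt (a : A)) * CFC.sqrt (a : A)
  rw [(IsSelfAdjoint.of_nonneg h0).star_eq, h1]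

end

/-- The algebra `A` as a right pre-Hilbert module over the fixed point algebra `F`: right
multiplication and the inner product `(a|b) = Φ(a⋆ b)`. -/
noncomputable instance : PreHilbertModule α.fixed A where
  ract a b := a * b
  inner a b := α.expectation (star a * b)
  ract_add_left _ _ _ := add_mul _ _ _
  ract_add_right _ _ _ := mul_add _ _ _
  ract_mul _ _ _ := (mul_assoc _ _ _).symm
  ract_smul_left _ _ _ := smul_mul_assoc _ _ _
  ract_smul_right _ _ _ := mul_smul_comm _ _ _
  inner_add_right x y z := Subtype.ext <| by
    simp only [mul_add]
    exact α.average_add _ _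
  inner_smul_right c x y := Subtype.ext <| by
    simp only [mul_smul_comm]
    exact α.average_smul _ _
  inner_ract_right x y b := Subtype.ext <| by
    simp only [← mul_assoc]
    exact α.average_mul_fixed _ b
  star_inner x y := Subtype.ext <| by
    change star (α.average _) = α.average _
    rw [← α.average_star, star_mul, star_star]
  inner_self_nonneg x := by
    let := CStarAlgebra.spectralOrder A
    have := CStarAlgebra.spectralOrderedRing A
    exact α.exists_fixed_sqrt _ (α.average_nonneg (star_mul_self_nonneg x))

open PreHilbertModule

lemma inner_def (a b : A) : ((inner α.fixed a b : α.fixed) : A) = α.average (star a * b) := rfl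

/-- The right Hilbert `F`-module `X`, the completion of `A` in the norm `‖Φ(x⋆ x)‖^{1/2}`. -/
abbrev X : Type v := HilbertCompletion α.fixed A

/-- The canonical map `A → X`. -/
noncomputable def toX (a : A) : α.X := ((Pre.of a : Pre α.fixed A) : Completion (Pre α.fixed A))

lemma norm_of_mul_le (a b : A) :
    ‖(Pre.of (a * b) : Pre α.fixed A)‖ ≤ ‖a‖ * ‖(Pre.of b : Pre α.fixed A)‖ := by
  let := CStarAlgebra.spectralOrder A
  have := CStarAlgebra.spectralOrderedRing A
  refine abs_le_of_sq_le_sq' ?_ (by positivity) |>.2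
  rw [mul_pow, pre_norm_sq, pre_norm_sq]
  change ‖α.average (star (a * b) * (a * b))‖ ≤ ‖a‖ ^ 2 * ‖α.average (star b * b)‖
  have h1 : star (a * b) * (a * b) ≤ ‖a‖ ^ 2 • (star b * b) := by
    have h2 := CStarAlgebra.star_left_conjugate_le_norm_smul (a := b) (b := star a * a)
      (.star_mul_self a)
    rw [CStarRing.norm_star_mul_self, ← pow_two] at h2
    simpa only [star_mul, mul_assoc] using h2
  have h3 := α.average_mono h1
  have h4 : α.average (‖a‖ ^ 2 • (star b * b)) = ‖a‖ ^ 2 • α.average (star b * b) := by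
    rw [← Complex.coe_smul, average_smul, Complex.coe_smul]
  rw [h4] at h3
  have h5 := CStarAlgebra.norm_le_norm_of_nonneg_of_le
    (α.average_nonneg (star_mul_self_nonneg (a * b))) h3
  rwa [norm_smul, Real.norm_of_nonneg (by positivity)] at h5

/-- Left multiplication by `a` on the dense subspace `A` of `X`. -/
noncomputable def preLeftMul (a : A) : Pre α.fixed A →L[ℂ] Pre α.fixed A :=
  LinearMap.mkContinuous (Pre.of.toLinearMap ∘ₗ LinearMap.mulLeft ℂ a ∘ₗ Pre.of.symm.toLinearMap)
    ‖a‖ (fun b => α.norm_of_mul_le a (Pre.of.symm b))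

lemma X_ext {S T : α.X →L[ℂ] α.X} (h : ∀ a : A, S (α.toX a) = T (α.toX a)) : S = T :=
  ContinuousLinearMap.ext fun x =>
    Completion.induction_on x (isClosed_eq S.continuous T.continuous) h

lemma toX_add (a b : A) : α.toX (a + b) = α.toX a + α.toX b := Completion.coe_add _ _

lemma toX_sub (a b : A) : α.toX (a - b) = α.toX a - α.toX b := Completion.coe_sub _ _

lemma toX_smul (c : ℂ) (a : A) : α.toX (c • a) = c • α.toX a := by
  rw [toX, map_smul, Completion.coe_smul, toX]

lemma complMap_preLeftMul (a b : A) : complMap (α.preLeftMul a) (α.toX b) = α.toX (a * b) :=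
  complMap_coe _ _

/-- The left action of `A` on `X` by multiplication. -/
noncomputable def leftMul : A →ₙₐ[ℂ] (α.X →L[ℂ] α.X) where
  toFun a := complMap (α.preLeftMul a)
  map_smul' c a := α.X_ext fun b => by
    change _ = c • complMap (α.preLeftMul a) (α.toX b)
    rw [complMap_preLeftMul, complMap_preLeftMul, smul_mul_assoc, toX_smul]
  map_zero' := α.X_ext fun b => by
    rw [complMap_preLeftMul, zero_mul]
    exact Completion.coe_zero
  map_add' a a' := α.X_ext fun b => by
    change _ = complMap (α.preLeftMul a) (α.toX b) + complMap (α.preLeftMul a') (α.toX b)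
    rw [complMap_preLeftMul, complMap_preLeftMul, complMap_preLeftMul, add_mul, toX_add]
  map_mul' a a' := α.X_ext fun b => by
    change _ = complMap (α.preLeftMul a) (complMap (α.preLeftMul a') (α.toX b))
    rw [complMap_preLeftMul, complMap_preLeftMul, complMap_preLeftMul, mul_assoc]

lemma inner_of_act (z : Circle) (a b : A) :
    inner α.fixed (Pre.of (α.act z a) : Pre α.fixed A) (Pre.of (α.act z b))
      = inner α.fixed (Pre.of a : Pre α.fixed A) (Pre.of b) := by
  refine Subtype.ext ?_
  change α.average (star (α.act z a) * α.act z b) = α.average (star a * b)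
  rw [← map_star, ← map_mul, average_act]

/-- The action of `z` on the dense subspace `A` of `X`. -/
noncomputable def preUnitary (z : Circle) : Pre α.fixed A →L[ℂ] Pre α.fixed A :=
  LinearMap.mkContinuous
    (Pre.of.toLinearMap ∘ₗ (α.actCLM z).toLinearMap ∘ₗ Pre.of.symm.toLinearMap) 1
    (fun b => by
      rw [one_mul, pre_norm_def, pre_norm_def]
      exact (congrArg (fun t => √‖t‖) (α.inner_of_act z (Pre.of.symm b) (Pre.of.symm b))).le)

/-- The unitary action of the circle on `X` which extends the action on `A`. -/
noncomputable def unitary (z : Circle) : α.X →L[ℂ] α.X := complMap (α.preUnitary z)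

lemma inner_unitary (z : Circle) (x y : α.X) :
    inner α.fixed (α.unitary z x) (α.unitary z y) = inner α.fixed x y := by
  refine Completion.induction_on₂ x y (isClosed_eq ?_ ?_) fun a b => ?_
  · exact Continuous.compl_inner ((α.unitary z).continuous.comp continuous_fst)
      ((α.unitary z).continuous.comp continuous_snd)
  · exact Continuous.compl_inner continuous_fst continuous_snd
  · rw [unitary, complMap_coe, complMap_coe, compl_inner_coe, compl_inner_coe]
    exact α.inner_of_act z (Pre.of.symm a) (Pre.of.symm b)

lemma norm_unitary (z : Circle) (x : α.X) : ‖α.unitary z x‖ = ‖x‖ := by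
  have h : ‖α.unitary z x‖ ^ 2 = ‖x‖ ^ 2 := by
    rw [compl_norm_sq_eq, compl_norm_sq_eq, inner_unitary]
  exact (pow_left_inj₀ (norm_nonneg _) (norm_nonneg _) two_ne_zero).1 h

lemma unitary_mul (z w : Circle) (x : α.X) :
    α.unitary (z * w) x = α.unitary z (α.unitary w x) := by
  refine Completion.induction_on x (isClosed_eq (ContinuousLinearMap.continuous _)
    ((ContinuousLinearMap.continuous _).comp (ContinuousLinearMap.continuous _))) fun a => ?_
  rw [unitary, unitary, unitary, complMap_coe, complMap_coe, complMap_coe]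
  exact congrArg _ (α.act_mul z w a)

lemma norm_average_le (a : A) : ‖α.average a‖ ≤ ‖a‖ := by
  have h : ‖∫ θ in (0 : ℝ)..2 * Real.pi, α.act (Circle.exp θ) a‖ ≤ ‖a‖ * |2 * Real.pi - 0| :=
    intervalIntegral.norm_integral_le_of_norm_le_const fun θ _ => (α.norm_act _ a).le
  rw [sub_zero, abs_of_pos Real.two_pi_pos] at h
  rw [average, norm_smul, norm_inv, Real.norm_of_nonneg Real.two_pi_pos.le,
    inv_mul_le_iff₀ Real.two_pi_pos]
  linarith

lemma norm_toX_le (a : A) : ‖α.toX a‖ ≤ ‖a‖ := by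
  refine abs_le_of_sq_le_sq' ?_ (norm_nonneg _) |>.2
  rw [toX, Completion.norm_coe, pre_norm_sq]
  refine (α.norm_average_le (star a * a)).trans ?_
  rw [CStarRing.norm_star_mul_self, pow_two]

lemma continuous_toX : Continuous α.toX := by
  have h : LipschitzWith 1 α.toX := LipschitzWith.of_dist_le_mul fun a b => by
    rw [NNReal.coe_one, one_mul, dist_eq_norm, dist_eq_norm]
    rw [← toX_sub]
    exact α.norm_toX_le _
  exact h.continuous

lemma continuous_unitary (x : α.X) : Continuous fun z => α.unitary z x := by
  refine Completion.induction_on (p := fun x : α.X => Continuous fun z => α.unitary z x) x ?_ ?_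
  · rw [← isSeqClosed_iff_isClosed]
    intro f y hf hy
    refine continuous_of_uniform_approx_of_continuous fun s hs => ?_
    obtain ⟨ε, hε, hεs⟩ := Metric.mem_uniformity_dist.1 hs
    obtain ⟨n, hn⟩ := ((Metric.tendsto_nhds.1 hy) ε hε).exists
    refine ⟨fun z => α.unitary z (f n), hf n, fun z => hεs ?_⟩
    rw [dist_comm, dist_eq_norm, ← map_sub, norm_unitary, ← dist_eq_norm]
    exact hn
  · intro a
    have : (fun z => α.unitary z (a : α.X)) = fun z => α.toX (α.act z a) := by
      ext z
      exact complMap_coe _ _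
    rw [this]
    exact α.continuous_toX.comp (α.continuous_act a)

lemma continuous_integrand (k : ℤ) (x : α.X) :
    Continuous fun θ : ℝ => ((Circle.exp θ : ℂ) ^ (-k)) • α.unitary (Circle.exp θ) x := by
  have h1 : Continuous fun θ : ℝ => ((Circle.exp θ : ℂ) ^ (-k)) :=
    (continuous_subtype_val.comp Circle.exp.continuous).zpow₀ _
      fun θ => Or.inl (Circle.coe_ne_zero _)
  exact h1.smul ((α.continuous_unitary x).comp Circle.exp.continuous)

/-- The projection `Φ_k(x) = (1/2π) ∫ z^{-k} U_z(x) dθ`, `z = e^{iθ}`, onto the `k`-th spectral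
subspace of the circle action on `X`. -/
noncomputable def spectralProj (k : ℤ) : α.X →ₗ[ℂ] α.X where
  toFun x := (2 * Real.pi)⁻¹ • ∫ θ in (0 : ℝ)..2 * Real.pi,
    ((Circle.exp θ : ℂ) ^ (-k)) • α.unitary (Circle.exp θ) x
  map_add' x y := by
    simp only [map_add, smul_add]
    rw [intervalIntegral.integral_add ((α.continuous_integrand k x).intervalIntegrable _ _)
      ((α.continuous_integrand k y).intervalIntegrable _ _), smul_add]
  map_smul' c x := by
    simp only [map_smul, RingHom.id_apply]
    rw [smul_comm c, ← intervalIntegral.integral_smul c]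
    congr 2
    funext θ
    rw [smul_comm]

lemma spectralProj_apply (k : ℤ) (x : α.X) : α.spectralProj k x =
    (2 * Real.pi)⁻¹ • ∫ θ in (0 : ℝ)..2 * Real.pi,
      ((Circle.exp θ : ℂ) ^ (-k)) • α.unitary (Circle.exp θ) x := rfl

lemma unitary_spectralProj (k : ℤ) (t : ℝ) (x : α.X) :
    α.unitary (Circle.exp t) (α.spectralProj k x)
      = ((Circle.exp t : ℂ) ^ k) • α.spectralProj k x := by
  have h1 : α.unitary (Circle.exp t) (α.spectralProj k x) = (2 * Real.pi)⁻¹ •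
      ∫ θ in (0 : ℝ)..2 * Real.pi, α.unitary (Circle.exp t)
        (((Circle.exp θ : ℂ) ^ (-k)) • α.unitary (Circle.exp θ) x) := by
    rw [spectralProj_apply, ← Complex.coe_smul, map_smul, Complex.coe_smul]
    congr 1
    exact (ContinuousLinearMap.intervalIntegral_comp_comm _
      ((α.continuous_integrand k x).intervalIntegrable _ _)).symm
  set f : ℝ → α.X := fun s => ((Circle.exp s : ℂ) ^ (-k)) • α.unitary (Circle.exp s) x with hf
  have h2 : (fun θ : ℝ => α.unitary (Circle.exp t)
      (((Circle.exp θ : ℂ) ^ (-k)) • α.unitary (Circle.exp θ) x))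
      = fun θ => ((Circle.exp t : ℂ) ^ k) • f (θ + t) := by
    funext θ
    rw [map_smul, ← unitary_mul, hf]
    simp only [Circle.exp_add, Circle.coe_mul]
    rw [smul_smul, mul_zpow, mul_comm (Circle.exp t)]
    congr 1
    rw [mul_left_comm, ← zpow_add₀ (Circle.coe_ne_zero _), add_neg_cancel, zpow_zero, mul_one]
  have hper : Function.Periodic f (2 * Real.pi) := fun s => by
    simp only [hf, Circle.exp_add, Circle.exp_two_pi, mul_one]
  have h3 := hper.intervalIntegral_add_eq t 0
  rw [zero_add] at h3
  rw [h1, h2, intervalIntegral.integral_smul, intervalIntegral.integral_comp_add_right f, zero_add,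
    add_comm (2 * Real.pi) t, h3, smul_comm]
  rfl

lemma inner_spectralProj_of_ne {k l : ℤ} (h : k ≠ l) (x y : α.X) :
    inner α.fixed (α.spectralProj k x) (α.spectralProj l y) = 0 := by
  have hkl : ((l - k : ℤ) : ℝ) ≠ 0 := by exact_mod_cast sub_ne_zero.2 h.symm
  set t : ℝ := Real.pi / ((l - k : ℤ) : ℝ) with ht
  have h1 := α.inner_unitary (Circle.exp t) (α.spectralProj k x) (α.spectralProj l y)
  rw [unitary_spectralProj, unitary_spectralProj, PreHilbertModule.inner_smul_left,
    PreHilbertModule.inner_smul_right, smul_smul] at h1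
  have h2 : star ((Circle.exp t : ℂ) ^ k) * (Circle.exp t : ℂ) ^ l = -1 := by
    have h3 : star ((Circle.exp t : ℂ) ^ k) = (Circle.exp t : ℂ) ^ (-k) := by
      rw [star_zpow₀, zpow_neg, ← inv_zpow]
      congr 1
      exact (Circle.coe_inv_eq_conj _).symm
    rw [h3, ← zpow_add₀ (Circle.coe_ne_zero _), neg_add_eq_sub, Circle.coe_exp,
      ← Complex.exp_int_mul, ← Complex.exp_pi_mul_I]
    congr 1
    rw [← mul_assoc]
    congr 1
    rw [ht]
    push_cast
    push_cast at hkl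
    field_simp
    rw [div_self]
    exact_mod_cast hkl
  rw [h2, neg_smul, one_smul] at h1
  have h4 : (2 : ℂ) • inner α.fixed (α.spectralProj k x) (α.spectralProj l y) = 0 := by
    rw [two_smul]
    nth_rewrite 1 [← h1]
    exact neg_add_cancel _
  exact (smul_eq_zero.1 h4).resolve_left two_ne_zero


/-- The generator `D x = ∑ k x_k`, `x_k = Φ_k(x)`, of the circle action on `X`; its domain
consists of all `x` for which `∑ k² (x_k|x_k)` converges. -/
noncomputable def generator : α.X →ₗ.[ℂ] α.X :=
  weightedSum α.fixed α.spectralProj fun _ _ h x y => α.inner_spectralProj_of_ne h x y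

end CircleAction

/-! ### Kasparov modules -/

section Kasparov

/-- `S` is the adjoint of the operator `T` on the Hilbert `B`-module `Y`. -/
def IsAdjointPair (B : Type v) [NonUnitalCStarAlgebra B] {Y : Type w} [NormedAddCommGroup Y]
    [NormedSpace ℂ Y] [HilbertModule B Y] (T S : Y →L[ℂ] Y) : Prop :=
  ∀ x y : Y, inner B (T x) y = inner B x (S y)

/-- The compact endomorphisms of the Hilbert `B`-module `Y`: the norm closure of the linear span
of the operators `Θ_{x,y} z = x (y|z)`. -/
noncomputable def compactEndomorphisms (B : Type v) [NonUnitalCStarAlgebra B] (Y : Type w)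
    [NormedAddCommGroup Y] [NormedSpace ℂ Y] [HilbertModule B Y] : Submodule ℂ (Y →L[ℂ] Y) :=
  (Submodule.span ℂ {T : Y →L[ℂ] Y |
    ∃ x y : Y, ∀ z, T z = PreHilbertModule.ract x (inner B y z)}).topologicalClosure

/-- The Hilbert `B`-module `Y` is generated, as a closed `B`-submodule of itself, by a countable
set. -/
def IsCountablyGenerated (B : Type v) [NonUnitalCStarAlgebra B] (Y : Type w)
    [NormedAddCommGroup Y] [NormedSpace ℂ Y] [HilbertModule B Y] : Prop :=
  ∃ s : Set Y, s.Countable ∧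
    Dense (Submodule.span ℂ (s ∪ {y | ∃ x ∈ s, ∃ b : B, y = PreHilbertModule.ract x b}) : Set Y)

/-- Let `Y` be a Hilbert `B`-module, `φ` a homomorphism from `A` to the operators on `Y` and `T` an
operator on `Y`.  Then `(Y, φ, T)` is an odd Kasparov `A`-`B`-module if `Y` is countably generated,
`φ` is a ⋆-homomorphism to the adjointable operators, `T` is adjointable and
`a(T - T⋆)`, `a(T² - 1)`, `[T, a]` are compact endomorphisms for all `a`. -/
structure IsOddKasparovModule {A : Type u} [NonUnitalCStarAlgebra A] (B : Type v)
    [NonUnitalCStarAlgebra B] {Y : Type w} [NormedAddCommGroup Y] [NormedSpace ℂ Y]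
    [HilbertModule B Y] (φ : A →ₙₐ[ℂ] (Y →L[ℂ] Y)) (T : Y →L[ℂ] Y) : Prop where
  countablyGenerated : IsCountablyGenerated B Y
  isAdjointPair : ∀ a, IsAdjointPair B (φ a) (φ (star a))
  exists_adjoint : ∃ S, IsAdjointPair B T S
  sub_adjoint : ∀ S, IsAdjointPair B T S → ∀ a, φ a * (T - S) ∈ compactEndomorphisms B Y
  sq_sub_one : ∀ a, φ a * (T * T - 1) ∈ compactEndomorphisms B Y
  commutator : ∀ a, T * φ a - φ a * T ∈ compactEndomorphisms B Y

/-- The odd Kasparov `A`-`B`-modules. -/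
structure OddKasparovModule (A B : Type v) [NonUnitalCStarAlgebra A] [NonUnitalCStarAlgebra B] :
    Type (v + 1) where
  /-- the Hilbert `B`-module -/
  carrier : Type v
  [normedAddCommGroup : NormedAddCommGroup carrier]
  [normedSpace : NormedSpace ℂ carrier]
  [hilbertModule : HilbertModule B carrier]
  /-- the left action of `A` -/
  action : A →ₙₐ[ℂ] (carrier →L[ℂ] carrier)
  /-- the operator -/
  op : carrier →L[ℂ] carrier
  isOddKasparovModule : IsOddKasparovModule B action op

attribute [instance] OddKasparovModule.normedAddCommGroup OddKasparovModule.normedSpace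
  OddKasparovModule.hilbertModule

variable {A B : Type v} [NonUnitalCStarAlgebra A] [NonUnitalCStarAlgebra B]

/-- The odd Kasparov `A`-`B`-module `K` is (unitarily equivalent to) the evaluation at `t` of the
odd Kasparov `A`-`C([0,1], B)`-module `H`.  As the evaluation `C([0,1], B) → B` is onto, the
interior tensor product of a Hilbert module with `B` along it is the quotient by the vectors
`x` with `(x|x)(t) = 0`; so the condition is that some map `q` of the underlying spaces is onto
and compatible with the inner products, the module actions, the left actions of `A` and the
operators. -/
def IsEvaluation (H : OddKasparovModule A C(unitInterval, B)) (t : unitInterval)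
    (K : OddKasparovModule A B) : Prop :=
  ∃ q : H.carrier →ₗ[ℂ] K.carrier, Function.Surjective q ∧
    (∀ x y, inner B (q x) (q y) = (inner C(unitInterval, B) x y) t) ∧
    (∀ (x : H.carrier) (f : C(unitInterval, B)),
      q (PreHilbertModule.ract x f) = PreHilbertModule.ract (q x) (f t)) ∧
    (∀ a x, q (H.action a x) = K.action a (q x)) ∧ ∀ x, q (H.op x) = K.op (q x)

/-- Homotopy of odd Kasparov `A`-`B`-modules. -/
def IsHomotopic (K L : OddKasparovModule A B) : Prop :=
  ∃ H : OddKasparovModule A C(unitInterval, B), IsEvaluation H 0 K ∧ IsEvaluation H 1 L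

variable (A B) in
/-- `KK¹(A, B)`: the homotopy classes of odd Kasparov `A`-`B`-modules. -/
def KK1 : Type (v + 1) := Quot (IsHomotopic : OddKasparovModule A B → OddKasparovModule A B → Prop)

/-- The class in `KK¹(A, B)` of an odd Kasparov `A`-`B`-module. -/
def KK1.classOf {Y : Type v} [NormedAddCommGroup Y] [NormedSpace ℂ Y] [HilbertModule B Y]
    (φ : A →ₙₐ[ℂ] (Y →L[ℂ] Y)) (T : Y →L[ℂ] Y) (h : IsOddKasparovModule B φ T) : KK1 A B :=
  Quot.mk _ ⟨Y, φ, T, h⟩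

end Kasparov

/-! ### The bounded transform of an unbounded operator -/

/-- `R` is the operator `(1 + D²)^{-1/2}`, that is, a positive operator whose square is the inverse
of the unbounded operator `1 + D²`, whose domain consists of all `x` in the domain of `D` such that
`D x` is in the domain of `D`. -/
structure IsInvSqrtOneAddSq (B : Type v) [NonUnitalCStarAlgebra B] {Y : Type w}
    [NormedAddCommGroup Y] [NormedSpace ℂ Y] [HilbertModule B Y] (D : Y →ₗ.[ℂ] Y)
    (R : Y →L[ℂ] Y) : Prop where
  nonneg : ∀ x, ∃ b : B, inner B x (R x) = star b * b
  right_inv : ∀ x, ∃ (h : R (R x) ∈ D.domain) (h' : D ⟨R (R x), h⟩ ∈ D.domain),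
    R (R x) + D ⟨D ⟨R (R x), h⟩, h'⟩ = x
  left_inv : ∀ (x : D.domain) (h : D x ∈ D.domain), R (R ((x : Y) + D ⟨D x, h⟩)) = x

/-- `V` is the operator `D (1 + D²)^{-1/2}`. -/
def IsBoundedTransform (B : Type v) [NonUnitalCStarAlgebra B] {Y : Type w}
    [NormedAddCommGroup Y] [NormedSpace ℂ Y] [HilbertModule B Y] (D : Y →ₗ.[ℂ] Y)
    (V : Y →L[ℂ] Y) : Prop :=
  ∃ R : Y →L[ℂ] Y, IsInvSqrtOneAddSq B D R ∧ ∀ x, ∃ h : R x ∈ D.domain, D ⟨R x, h⟩ = V x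

/-! ### Graph C⋆-algebras -/

/-- A directed graph with vertices `V` and edges `E`. -/
structure DirectedGraph (V E : Type u) where
  /-- the source of an edge -/
  s : E → V
  /-- the range of an edge -/
  r : E → V

lemma circle_mul_star (z : Circle) : (z : ℂ) * star (z : ℂ) = 1 := by
  rw [RCLike.star_def, Complex.mul_conj, Circle.normSq_coe, Complex.ofReal_one]

lemma continuous_starHom {A : Type v} {B : Type w} [NonUnitalCStarAlgebra A]
    [NonUnitalCStarAlgebra B] (π : A →⋆ₙₐ[ℂ] B) : Continuous π :=
  AddMonoidHomClass.continuous_of_bound π 1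
    (fun a => by simpa using NonUnitalStarAlgHom.norm_apply_le π a)

namespace DirectedGraph

variable {V E : Type u} (G : DirectedGraph V E)

/-- Every vertex emits and receives only finitely many edges. -/
def LocallyFinite : Prop := ∀ v, {e | G.s e = v}.Finite ∧ {e | G.r e = v}.Finite

/-- Every vertex receives an edge. -/
def NoSources : Prop := ∀ v, ∃ e, G.r e = v

/-- A Cuntz–Krieger family of the (row-finite) graph `G` in the C⋆-algebra `B`. -/
structure CKFamily (B : Type w) [NonUnitalCStarAlgebra B] where
  /-- the projections -/
  p : V → B
  /-- the partial isometries -/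
  S : E → B
  isStarProjection_p : ∀ v, IsStarProjection (p v)
  p_mul_p : ∀ v w, v ≠ w → p v * p w = 0
  S_mul_star_mul_S : ∀ e, S e * star (S e) * S e = S e
  star_S_mul_S : ∀ e, star (S e) * S e = p (G.r e)
  p_eq_sum : ∀ v (h : {e | G.s e = v}.Finite), {e | G.s e = v}.Nonempty →
    p v = ∑ e ∈ h.toFinset, S e * star (S e)

namespace CKFamily

variable {G} {B : Type w} [NonUnitalCStarAlgebra B] (f : G.CKFamily B)

lemma norm_p_le (v : V) : ‖f.p v‖ ≤ 1 := by
  have h := f.isStarProjection_p v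
  have h1 : ‖f.p v‖ = ‖f.p v‖ * ‖f.p v‖ := by
    rw [← CStarRing.norm_star_mul_self, h.isSelfAdjoint.star_eq, h.isIdempotentElem.eq]
  nlinarith [norm_nonneg (f.p v)]

lemma norm_S_le (e : E) : ‖f.S e‖ ≤ 1 := by
  have h1 : ‖f.S e‖ * ‖f.S e‖ ≤ 1 := by
    rw [← CStarRing.norm_star_mul_self, f.star_S_mul_S]
    exact f.norm_p_le _
  nlinarith [norm_nonneg (f.S e)]

/-- The Cuntz–Krieger family `{p_v, z S_e}`. -/
@[reducible]
def rotate (z : Circle) : G.CKFamily B where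
  p := f.p
  S e := (z : ℂ) • f.S e
  isStarProjection_p := f.isStarProjection_p
  p_mul_p := f.p_mul_p
  S_mul_star_mul_S e := by
    simp only [star_smul, smul_mul_assoc, mul_smul_comm, smul_smul]
    rw [mul_comm (star (z : ℂ)), circle_mul_star, mul_one, f.S_mul_star_mul_S]
  star_S_mul_S e := by
    rw [star_smul, smul_mul_assoc, mul_smul_comm, smul_smul, mul_comm, circle_mul_star, one_smul,
      f.star_S_mul_S]
  p_eq_sum v h hv := by
    rw [f.p_eq_sum v h hv]
    refine Finset.sum_congr rfl fun e _ => ?_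
    rw [star_smul, smul_mul_assoc, mul_smul_comm, smul_smul, circle_mul_star, one_smul]

end CKFamily

/-- A C⋆-algebra together with a Cuntz–Krieger family of `G` in it. -/
structure CKRep : Type (u + 1) where
  /-- the C⋆-algebra -/
  carrier : Type u
  [inst : NonUnitalCStarAlgebra carrier]
  /-- the Cuntz–Krieger family -/
  fam : G.CKFamily carrier

attribute [instance] CKRep.inst

/-- The bounded families of elements of all C⋆-algebras with a Cuntz–Krieger family. -/
abbrev Universe : Type (u + 1) := lp (fun i : G.CKRep => i.carrier) ∞

/-- The projections of the universal Cuntz–Krieger family. -/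
noncomputable def univP (v : V) : G.Universe :=
  ⟨fun i => i.fam.p v, memℓp_infty ⟨1, by rintro _ ⟨i, rfl⟩; exact i.fam.norm_p_le v⟩⟩

/-- The partial isometries of the universal Cuntz–Krieger family. -/
noncomputable def univS (e : E) : G.Universe :=
  ⟨fun i => i.fam.S e, memℓp_infty ⟨1, by rintro _ ⟨i, rfl⟩; exact i.fam.norm_S_le e⟩⟩

/-- The C⋆-subalgebra generated by the universal Cuntz–Krieger family. -/
noncomputable def univSubalgebra : NonUnitalStarSubalgebra ℂ G.Universe :=
  (NonUnitalStarAlgebra.adjoin ℂ (Set.range G.univP ∪ Set.range G.univS)).topologicalClosure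

instance : IsClosed (G.univSubalgebra : Set G.Universe) :=
  NonUnitalStarSubalgebra.isClosed_topologicalClosure _

/-- The graph C⋆-algebra `C⋆(G)`: the C⋆-algebra generated by the universal Cuntz–Krieger family,
whose component in a C⋆-algebra with a Cuntz–Krieger family is that Cuntz–Krieger family. -/
def Alg : Type (u + 1) := G.univSubalgebra

noncomputable instance : NonUnitalCStarAlgebra G.Alg :=
  inferInstanceAs (NonUnitalCStarAlgebra G.univSubalgebra)

lemma univP_mem (v : V) : G.univP v ∈ G.univSubalgebra :=
  NonUnitalStarSubalgebra.le_topologicalClosure _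
    (NonUnitalStarAlgebra.subset_adjoin ℂ _ (Or.inl ⟨v, rfl⟩))

lemma univS_mem (e : E) : G.univS e ∈ G.univSubalgebra :=
  NonUnitalStarSubalgebra.le_topologicalClosure _
    (NonUnitalStarAlgebra.subset_adjoin ℂ _ (Or.inr ⟨e, rfl⟩))

/-- The generating projections of `C⋆(G)`. -/
noncomputable def p (v : V) : G.Alg := (⟨G.univP v, G.univP_mem v⟩ : G.univSubalgebra)

/-- The generating partial isometries of `C⋆(G)`. -/
noncomputable def S (e : E) : G.Alg := (⟨G.univS e, G.univS_mem e⟩ : G.univSubalgebra)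

/-- The evaluation of an element of `C⋆(G)` at a Cuntz–Krieger family. -/
noncomputable def eval (i : G.CKRep) : G.Alg →⋆ₙₐ[ℂ] i.carrier where
  toFun a := (a : G.univSubalgebra).1 i
  map_smul' _ _ := rfl
  map_zero' := rfl
  map_add' _ _ := rfl
  map_mul' _ _ := rfl
  map_star' _ := rfl

variable {G} in
lemma alg_ext {a b : G.Alg} (h : ∀ i, G.eval i a = G.eval i b) : a = b :=
  Subtype.ext (lp.ext (funext h))

/-- Induction principle: a closed property of elements of `C⋆(G)`. -/
lemma alg_induction {q : G.Alg → Prop} (hc : IsClosed {a | q a}) (hp : ∀ v, q (G.p v))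
    (hS : ∀ e, q (G.S e)) (h0 : q 0) (hadd : ∀ a b, q a → q b → q (a + b))
    (hmul : ∀ a b, q a → q b → q (a * b)) (hsmul : ∀ (c : ℂ) a, q a → q (c • a))
    (hstar : ∀ a, q a → q (star a)) (a : G.Alg) : q a := by
  let T : NonUnitalStarSubalgebra ℂ G.Alg :=
    { carrier := {a | q a}
      add_mem' := fun {a b} ha hb => hadd a b ha hb
      zero_mem' := h0
      mul_mem' := fun {a b} ha hb => hmul a b ha hb
      smul_mem' := fun c a ha => hsmul c a ha
      star_mem' := fun {a} ha => hstar a ha }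
  let ι : G.Alg →⋆ₙₐ[ℂ] G.Universe := NonUnitalStarSubalgebraClass.subtype G.univSubalgebra
  have hι : Topology.IsClosedEmbedding ι :=
    (inferInstance : IsClosed (G.univSubalgebra : Set G.Universe)).isClosedEmbedding_subtypeVal
  have h1 : G.univSubalgebra ≤ T.map ι := by
    refine NonUnitalStarSubalgebra.topologicalClosure_minimal _ ?_ ?_
    · refine NonUnitalStarAlgebra.adjoin_le ?_
      rintro _ (⟨v, rfl⟩ | ⟨e, rfl⟩)
      · exact ⟨G.p v, hp v, rfl⟩
      · exact ⟨G.S e, hS e, rfl⟩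
    · exact hι.isClosedMap _ hc
  obtain ⟨b, hb, hba⟩ := h1 (show ι a ∈ G.univSubalgebra from Subtype.property a)
  exact (hι.injective hba) ▸ hb

/-- The generators of `C⋆(G)` form a Cuntz–Krieger family. -/
noncomputable def univFamily : G.CKFamily G.Alg where
  p := G.p
  S := G.S
  isStarProjection_p v :=
    ⟨alg_ext fun i => (i.fam.isStarProjection_p v).isIdempotentElem,
      alg_ext fun i => (i.fam.isStarProjection_p v).isSelfAdjoint⟩
  p_mul_p v w h := alg_ext fun i => i.fam.p_mul_p v w h
  S_mul_star_mul_S e := alg_ext fun i => i.fam.S_mul_star_mul_S e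
  star_S_mul_S e := alg_ext fun i => i.fam.star_S_mul_S e
  p_eq_sum v h hv := alg_ext fun i => by
    rw [map_sum]
    exact i.fam.p_eq_sum v h hv

variable {G} in
lemma alg_hom_ext {B : Type w} [NonUnitalCStarAlgebra B] {π π' : G.Alg →⋆ₙₐ[ℂ] B}
    (hp : ∀ v, π (G.p v) = π' (G.p v)) (hS : ∀ e, π (G.S e) = π' (G.S e)) : π = π' := by
  ext a
  refine G.alg_induction (isClosed_eq (continuous_starHom π) (continuous_starHom π')) hp hS
    ?_ ?_ ?_ ?_ ?_ a
  · rw [map_zero, map_zero]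
  · intro a b ha hb
    rw [map_add, map_add, ha, hb]
  · intro a b ha hb
    rw [map_mul, map_mul, ha, hb]
  · intro c a ha
    rw [map_smul, map_smul, ha]
  · intro a ha
    rw [map_star, map_star, ha]

/-- The universal property of `C⋆(G)`. -/
theorem exists_unique_hom {B : Type u} [NonUnitalCStarAlgebra B] (f : G.CKFamily B) :
    ∃! π : G.Alg →⋆ₙₐ[ℂ] B, (∀ v, π (G.p v) = f.p v) ∧ ∀ e, π (G.S e) = f.S e :=
  ⟨G.eval ⟨B, f⟩, ⟨fun _ => rfl, fun _ => rfl⟩,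
    fun _ h => alg_hom_ext (fun v => h.1 v) (fun e => h.2 e)⟩

/-- The Cuntz–Krieger family `{p_v, z S_e}` in the same C⋆-algebra. -/
@[reducible]
def CKRep.rotate (z : Circle) (i : G.CKRep) : G.CKRep := ⟨i.carrier, i.fam.rotate z⟩

/-- Reindexing of the components along the map which takes `{p_v, S_e}` to `{p_v, z S_e}`. -/
noncomputable def univGauge (z : Circle) : G.Universe →⋆ₙₐ[ℂ] G.Universe where
  toFun a := ⟨fun i => a.1 (CKRep.rotate G z i), memℓp_infty ⟨‖a‖, by
    rintro _ ⟨i, rfl⟩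
    exact lp.norm_apply_le_norm ENNReal.top_ne_zero a (CKRep.rotate G z i)⟩⟩
  map_smul' _ _ := rfl
  map_zero' := rfl
  map_add' _ _ := rfl
  map_mul' _ _ := rfl
  map_star' _ := rfl

lemma univGauge_mem (z : Circle) (a : G.Alg) :
    G.univGauge z (a : G.univSubalgebra).1 ∈ G.univSubalgebra := by
  refine G.alg_induction
    (q := fun a => G.univGauge z (a : G.univSubalgebra).1 ∈ G.univSubalgebra)
    ?_ ?_ ?_ ?_ ?_ ?_ ?_ ?_ a
  · exact (inferInstance : IsClosed (G.univSubalgebra : Set G.Universe)).preimage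
      ((continuous_starHom (G.univGauge z)).comp continuous_subtype_val)
  · exact fun v => G.univP_mem v
  · exact fun e => SMulMemClass.smul_mem (z : ℂ) (G.univS_mem e)
  · exact zero_mem G.univSubalgebra
  · exact fun a b ha hb => add_mem ha hb
  · exact fun a b ha hb => mul_mem ha hb
  · exact fun c a ha => SMulMemClass.smul_mem c ha
  · exact fun a ha => star_mem ha

/-- The automorphism `γ_z` of `C⋆(G)`, with `γ_z(p_v) = p_v` and `γ_z(S_e) = z S_e`. -/
noncomputable def gaugeHom (z : Circle) : G.Alg →⋆ₙₐ[ℂ] G.Alg where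
  toFun a := (⟨G.univGauge z (a : G.univSubalgebra).1, G.univGauge_mem z a⟩ : G.univSubalgebra)
  map_smul' _ _ := rfl
  map_zero' := rfl
  map_add' _ _ := rfl
  map_mul' _ _ := rfl
  map_star' _ := rfl

lemma gaugeHom_p (z : Circle) (v : V) : G.gaugeHom z (G.p v) = G.p v := rfl

lemma gaugeHom_S (z : Circle) (e : E) : G.gaugeHom z (G.S e) = (z : ℂ) • G.S e := rfl

lemma continuous_gaugeHom (a : G.Alg) : Continuous fun z => G.gaugeHom z a := by
  refine G.alg_induction (q := fun a => Continuous fun z => G.gaugeHom z a)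
    ?_ ?_ ?_ ?_ ?_ ?_ ?_ ?_ a
  · rw [← isSeqClosed_iff_isClosed]
    intro f y hf hy
    refine continuous_of_uniform_approx_of_continuous fun s hs => ?_
    obtain ⟨ε, hε, hεs⟩ := Metric.mem_uniformity_dist.1 hs
    obtain ⟨n, hn⟩ := ((Metric.tendsto_nhds.1 hy) ε hε).exists
    refine ⟨fun z => G.gaugeHom z (f n), hf n, fun z => hεs ?_⟩
    rw [dist_comm, dist_eq_norm, ← map_sub]
    refine (NonUnitalStarAlgHom.norm_apply_le (G.gaugeHom z) _).trans_lt ?_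
    rw [← dist_eq_norm]
    exact hn
  · exact fun v => (continuous_const : Continuous fun _ : Circle => G.p v)
  · exact fun e => (continuous_subtype_val.smul continuous_const :
      Continuous fun z : Circle => (z : ℂ) • G.S e)
  · simp only [map_zero]
    exact continuous_const
  · intro a b ha hb
    simp only [map_add]
    exact ha.add hb
  · intro a b ha hb
    simp only [map_mul]
    exact ha.mul hb
  · intro c a ha
    simp only [map_smul]
    exact ha.const_smul c
  · intro a ha
    simp only [map_star]
    exact ha.star

/-- The gauge action on `C⋆(G)`. -/
noncomputable def gauge : CircleAction G.Alg where
  act := G.gaugeHom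
  act_one a := by
    have h : G.gaugeHom 1 = NonUnitalStarAlgHom.id ℂ G.Alg :=
      alg_hom_ext (fun v => rfl) fun e => by
        rw [gaugeHom_S, Circle.coe_one, one_smul]
        rfl
    rw [h]
    rfl
  act_mul z w a := by
    have h : G.gaugeHom (z * w) = (G.gaugeHom z).comp (G.gaugeHom w) :=
      alg_hom_ext (fun v => rfl) fun e => by
        rw [NonUnitalStarAlgHom.comp_apply, gaugeHom_S, gaugeHom_S, map_smul, gaugeHom_S,
          smul_smul, Circle.coe_mul, mul_comm]
    rw [h]
    rfl
  continuous_act := G.continuous_gaugeHom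

end DirectedGraph

end GraphKK

/-! Write Φ_k for the spectral projections, f(k) = k(1 + k²)^{-1/2} and r(k) = (1 + k²)^{-1/2}. The
Φ_k are mutually orthogonal and self-adjoint. Products of the generators and their adjoints are
homogeneous for the gauge action and span a dense subspace of `G.Alg`, so the ranges of the Φ_k span
a dense subspace of X. Every bounded sequence c therefore defines an operator ∑ c_k Φ_k
(`IsGrading.diag`), and the generator is diagonal with eigenvalues k. A positive square root of the
inverse of 1 + D² has to be ∑ r(k) Φ_k, which makes V = ∑ f(k) Φ_k the only bounded transform
(`IsGrading.isBoundedTransform_iff`). As f is real, V is self-adjoint.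

The two remaining Kasparov conditions concern diagonal operators as well. One has V² - 1 = -∑ r(k)²
Φ_k. For a of degree n the relation aΦ_k = Φ_{k+n}a gives [V, a] = a ∑ (f(k+n) - f(k)) Φ_k, and a
general a follows by density. Both coefficient sequences tend to zero, so a(V² - 1) and [V, a] are
norm limits of finite combinations of the operators aΦ_k
(`IsGrading.mul_diag_mem_compactEndomorphisms`). It remains to see that aΦ_k is compact for all a
and k.

For fixed k the a with this property form a closed left ideal I_k
(`HasDenseHomogeneous.compactIdeal`). It suffices that I_k contains all p_v, since S_e = S_e
p_{r(e)} and S_e⋆ = S_e⋆ p_{s(e)}. If b has degree n, then Θ_{a,b} = a b⋆ Φ_n; hence p_v lies in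
I_0. From there one moves by one degree at a time. Going up, p_v = ∑ S_e p_{r(e)} S_e⋆ turns
compactness of the p_{r(e)} Φ_k into that of p_v Φ_{k+1}. This fails at a sink, but there p_v A is
spanned by elements of degree ≤ 0, so that p_v Φ_k = 0 for k > 0. Going down, v = r(e) for some e
because there are no sources, and p_v = S_e⋆ p_{s(e)} S_e. -/

namespace GraphKK

/-! ### Adjoints and compact endomorphisms -/

section HilbertModules

variable {B : Type v} [NonUnitalCStarAlgebra B] {Y : Type w} [NormedAddCommGroup Y]
  [NormedSpace ℂ Y] [HilbertModule B Y]

namespace HilbertModule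

lemma norm_inner_le (x y : Y) : ‖inner B x y‖ ≤ ‖x‖ * ‖y‖ := by
  refine abs_le_of_sq_le_sq' ?_ (by positivity) |>.2
  rw [mul_pow, norm_sq_eq (B := B) x, norm_sq_eq (B := B) y]
  exact PreHilbertModule.norm_inner_sq_le x y

variable (B) in
/-- The bounded linear map `y ↦ (x|y)`. -/
noncomputable def innerCLM (x : Y) : Y →L[ℂ] B :=
  LinearMap.mkContinuous
    { toFun := fun y => inner B x y
      map_add' := PreHilbertModule.inner_add_right x
      map_smul' := fun c y => PreHilbertModule.inner_smul_right c x y } ‖x‖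
    (fun y => norm_inner_le x y)

@[simp]
lemma innerCLM_apply (x y : Y) : innerCLM B x y = inner B x y := rfl

lemma eq_zero_of_inner_self {x : Y} (h : inner B x x = 0) : x = 0 := by
  have h1 := norm_sq_eq (B := B) x
  rw [h, norm_zero] at h1
  exact norm_eq_zero.1 (pow_eq_zero_iff two_ne_zero |>.1 h1)

lemma ext_inner {x y : Y} (h : ∀ z, inner B z x = inner B z y) : x = y := by
  refine sub_eq_zero.1 (eq_zero_of_inner_self (B := B) ?_)
  rw [PreHilbertModule.inner_sub_right, h, sub_self]

lemma norm_ract_le (x : Y) (b : B) : ‖PreHilbertModule.ract x b‖ ≤ ‖x‖ * ‖b‖ := by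
  refine abs_le_of_sq_le_sq' ?_ (by positivity) |>.2
  rw [norm_sq_eq (B := B), PreHilbertModule.inner_ract_left, PreHilbertModule.inner_ract_right,
    mul_pow, norm_sq_eq (B := B) x]
  calc _ ≤ ‖star b‖ * (‖inner B x x‖ * ‖b‖) :=
        (norm_mul_le _ _).trans (by gcongr; exact norm_mul_le _ _)
    _ = _ := by rw [norm_star]; ring

variable (B) in
/-- The operator `Θ_{x,y} z = x (y|z)`. -/
noncomputable def rankOne (x y : Y) : Y →L[ℂ] Y :=
  LinearMap.mkContinuous
    { toFun := fun z => PreHilbertModule.ract x (inner B y z)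
      map_add' := fun z z' => by
        rw [PreHilbertModule.inner_add_right, PreHilbertModule.ract_add_right]
      map_smul' := fun c z => by
        rw [PreHilbertModule.inner_smul_right, PreHilbertModule.ract_smul_right,
          RingHom.id_apply] } (‖x‖ * ‖y‖)
    (fun z => (norm_ract_le x _).trans (by
      rw [mul_assoc]
      gcongr
      exact norm_inner_le y z))

lemma rankOne_apply (x y z : Y) : rankOne B x y z = PreHilbertModule.ract x (inner B y z) := rfl

end HilbertModule

namespace IsAdjointPair

lemma symm {T S : Y →L[ℂ] Y} (h : IsAdjointPair B T S) : IsAdjointPair B S T := fun x y => by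
  rw [← PreHilbertModule.star_inner, ← h, PreHilbertModule.star_inner]

lemma eq {T S S' : Y →L[ℂ] Y} (h : IsAdjointPair B T S) (h' : IsAdjointPair B T S') : S = S' :=
  ContinuousLinearMap.ext fun y => HilbertModule.ext_inner (B := B) fun z => by
    rw [← h, h']

/-- Operators are only assumed ℂ-linear; linearity over `B` comes from the existence of an adjoint,
and it is what makes T Θ_{x,y} = Θ_{Tx,y} hold. -/
lemma map_ract {T S : Y →L[ℂ] Y} (h : IsAdjointPair B T S) (x : Y) (b : B) :
    T (PreHilbertModule.ract x b) = PreHilbertModule.ract (T x) b :=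
  HilbertModule.ext_inner (B := B) fun z => by
    rw [← h.symm, PreHilbertModule.inner_ract_right, PreHilbertModule.inner_ract_right, h.symm]

end IsAdjointPair

namespace compactEndomorphisms

lemma isClosed : IsClosed (compactEndomorphisms B Y : Set (Y →L[ℂ] Y)) :=
  Submodule.isClosed_topologicalClosure _

lemma rankOne_mem {T : Y →L[ℂ] Y} (x y : Y)
    (h : ∀ z, T z = PreHilbertModule.ract x (inner B y z)) : T ∈ compactEndomorphisms B Y :=
  Submodule.le_topologicalClosure _ (Submodule.subset_span ⟨x, y, h⟩)

lemma mul_mem_left {T S K : Y →L[ℂ] Y} (hT : IsAdjointPair B T S)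
    (hK : K ∈ compactEndomorphisms B Y) : T * K ∈ compactEndomorphisms B Y := by
  have h : compactEndomorphisms B Y ≤
      (compactEndomorphisms B Y).comap (LinearMap.mulLeft ℂ T) := by
    refine Submodule.topologicalClosure_minimal _ (Submodule.span_le.2 ?_) ?_
    · rintro L ⟨x, y, hL⟩
      refine rankOne_mem (T x) y fun z => ?_
      rw [← hT.map_ract, ← hL]
      rfl
    · exact isClosed.preimage (continuous_const.mul continuous_id)
  exact h hK

/-- This rests on Θ_{x,y} T = Θ_{x,Sy}, extended to spans and norm limits. -/
lemma mul_mem_right {T S K : Y →L[ℂ] Y} (hT : IsAdjointPair B T S)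
    (hK : K ∈ compactEndomorphisms B Y) : K * T ∈ compactEndomorphisms B Y := by
  have h : compactEndomorphisms B Y ≤
      (compactEndomorphisms B Y).comap (LinearMap.mulRight ℂ T) := by
    refine Submodule.topologicalClosure_minimal _ (Submodule.span_le.2 ?_) ?_
    · rintro L ⟨x, y, hL⟩
      refine rankOne_mem x (S y) fun z => ?_
      rw [hT.symm, ← hL]
      rfl
    · exact isClosed.preimage (continuous_id.mul continuous_const)
  exact h hK

end compactEndomorphisms

/-! ### Gradings of a Hilbert module and diagonal operators -/

variable (B) in
/-- Mutually orthogonal contractive projections `P_k` of a Hilbert module, the ranges of which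
span a dense subspace. -/
structure IsGrading (P : ℤ → Y →ₗ[ℂ] Y) : Prop where
  orthogonal : ∀ k l, k ≠ l → ∀ x y, inner B (P k x) (P l y) = 0
  proj_self : ∀ k x, P k (P k x) = P k x
  proj_of_ne : ∀ k l, k ≠ l → ∀ x, P k (P l x) = 0
  norm_le : ∀ k x, ‖P k x‖ ≤ ‖x‖
  dense : Dense (Submodule.span ℂ {y | ∃ k x, y = P k x} : Set Y)

namespace IsGrading

variable {P : ℤ → Y →ₗ[ℂ] Y}

/-- The projection `P_k` as a bounded operator. -/
noncomputable def proj (hP : IsGrading B P) (k : ℤ) : Y →L[ℂ] Y :=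
  (P k).mkContinuous 1 fun x => by simpa using hP.norm_le k x

lemma proj_apply (hP : IsGrading B P) (k : ℤ) (x : Y) : hP.proj k x = P k x := rfl

lemma ext_clm (hP : IsGrading B P)
    {F : Type*} [NormedAddCommGroup F] [NormedSpace ℂ F] {S T : Y →L[ℂ] F}
    (h : ∀ k x, S (P k x) = T (P k x)) : S = T :=
  ContinuousLinearMap.ext_on hP.dense (by rintro _ ⟨k, x, rfl⟩; exact h k x)

/-- The content is that x - P_k x is orthogonal to the range of P_k. Both sides are continuous in x,
so x may be taken in the range of some P_l, where orthogonality decides. Self-adjointness of P_k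
follows. -/
lemma inner_proj_proj (hP : IsGrading B P)
    (k : ℤ) (x y : Y) : inner B (P k x) (P k y) = inner B x (P k y) := by
  have h : HilbertModule.innerCLM B (P k y) ∘L hP.proj k = HilbertModule.innerCLM B (P k y) := by
    refine hP.ext_clm fun l z => ?_
    simp only [ContinuousLinearMap.comp_apply, proj_apply, HilbertModule.innerCLM_apply]
    by_cases hkl : k = l
    · rw [← hkl, hP.proj_self]
    · rw [hP.proj_of_ne k l hkl, PreHilbertModule.inner_zero_right, hP.orthogonal k l hkl]
  have h1 := congrArg star (congrArg (fun T => T x) h)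
  simpa [proj_apply, PreHilbertModule.star_inner] using h1

lemma inner_proj_left (hP : IsGrading B P)
    (k : ℤ) (x y : Y) : inner B (P k x) y = inner B x (P k y) := by
  rw [← hP.inner_proj_proj, ← PreHilbertModule.star_inner, ← hP.inner_proj_proj k y x,
    PreHilbertModule.star_inner]

lemma norm_sq_sum (hP : IsGrading B P) (s : Finset ℤ) (c : ℤ → ℂ) (x : Y) :
    ‖∑ k ∈ s, c k • P k x‖ ^ 2 = ‖∑ k ∈ s, ‖c k‖ ^ 2 • inner B (P k x) (P k x)‖ := by
  rw [HilbertModule.norm_sq_eq (B := B), inner_sum_sum]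
  · congr 1
    refine Finset.sum_congr rfl fun k _ => ?_
    rw [PreHilbertModule.inner_smul_left, PreHilbertModule.inner_smul_right, smul_smul,
      ← Complex.coe_smul]
    congr 1
    rw [RCLike.star_def, RCLike.conj_mul]
    norm_cast
  · intro k l hkl
    rw [PreHilbertModule.inner_smul_left, PreHilbertModule.inner_smul_right,
      hP.orthogonal k l hkl, smul_zero, smul_zero]

/-- With Q = ∑ P_k over s one has (Qx|Qx) = (x|Qx), so Cauchy–Schwarz gives ‖Qx‖² ≤ ‖x‖ ‖Qx‖. -/
lemma norm_sum_proj_le (hP : IsGrading B P) (s : Finset ℤ) (x : Y) : ‖∑ k ∈ s, P k x‖ ≤ ‖x‖ := by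
  have h : inner B (∑ k ∈ s, P k x) (∑ k ∈ s, P k x) = inner B x (∑ k ∈ s, P k x) := by
    rw [inner_sum_sum B (fun k l hkl => hP.orthogonal k l hkl x x),
      ← HilbertModule.innerCLM_apply x, map_sum]
    exact Finset.sum_congr rfl fun k _ => hP.inner_proj_proj k x x
  have h1 := HilbertModule.norm_sq_eq (B := B) (∑ k ∈ s, P k x)
  have h2 := HilbertModule.norm_inner_le (B := B) x (∑ k ∈ s, P k x)
  rw [h] at h1
  by_contra! h3
  nlinarith [norm_nonneg x, norm_nonneg (∑ k ∈ s, P k x)]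

/-- By orthogonality the squared norm is that of ∑ |c_k|² (P_k x|P_k x), and this positive element
is at most M² ∑ (P_k x|P_k x). The C⋆-norm is monotone on positive elements. The bound does not
depend on s. -/
lemma norm_sum_le (hP : IsGrading B P)
    (s : Finset ℤ) {c : ℤ → ℂ} {M : ℝ} (hM : ∀ k, ‖c k‖ ≤ M) (x : Y) :
    ‖∑ k ∈ s, c k • P k x‖ ≤ M * ‖x‖ := by
  let := CStarAlgebra.spectralOrder B
  have := CStarAlgebra.spectralOrderedRing B
  have hM0 : 0 ≤ M := (norm_nonneg _).trans (hM 0)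
  have h1 : ‖∑ k ∈ s, c k • P k x‖ ^ 2 ≤ (M * ‖∑ k ∈ s, P k x‖) ^ 2 := by
    have h2 := hP.norm_sq_sum s (fun _ => 1) x
    simp only [one_smul, norm_one, one_pow] at h2
    rw [hP.norm_sq_sum, mul_pow, h2, ← Real.norm_of_nonneg (sq_nonneg M), ← norm_smul,
      Finset.smul_sum]
    refine CStarAlgebra.norm_le_norm_of_nonneg_of_le
      (Finset.sum_nonneg fun k _ => smul_nonneg (by positivity)
        (PreHilbertModule.inner_self_nonneg' _))
      (Finset.sum_le_sum fun k _ => ?_)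
    refine smul_le_smul_of_nonneg_right ?_ (PreHilbertModule.inner_self_nonneg' _)
    gcongr
    exact hM k
  refine (abs_le_of_sq_le_sq' h1 (by positivity)).2.trans ?_
  gcongr
  exact hP.norm_sum_proj_le s x

lemma exists_finset_of_mem_span (hP : IsGrading B P)
    {y : Y} (hy : y ∈ Submodule.span ℂ {y | ∃ k x, y = P k x}) :
    ∃ s : Finset ℤ, ∀ k ∉ s, P k y = 0 := by
  induction hy using Submodule.span_induction with
  | mem y h =>
    obtain ⟨k, x, rfl⟩ := h
    exact ⟨{k}, fun l hl => hP.proj_of_ne l k (by simpa using hl) x⟩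
  | zero => exact ⟨∅, fun k _ => map_zero _⟩
  | add x y _ _ hx hy =>
    obtain ⟨s, hs⟩ := hx
    obtain ⟨t, ht⟩ := hy
    refine ⟨s ∪ t, fun k hk => ?_⟩
    rw [Finset.notMem_union] at hk
    rw [map_add, hs k hk.1, ht k hk.2, add_zero]
  | smul c x _ hx =>
    obtain ⟨s, hs⟩ := hx
    exact ⟨s, fun k hk => by rw [map_smul, hs k hk, smul_zero]⟩

/-- This is the Cauchy criterion for ∑ c_k P_k x. Approximate x by some y with finitely many
components; a sum over indices outside those components only sees x - y, and `norm_sum_le` applies.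
-/
lemma exists_finset_norm_sum_lt (hP : IsGrading B P)
    {c : ℤ → ℂ} {M : ℝ} (hM : ∀ k, ‖c k‖ ≤ M) (x : Y) {ε : ℝ}
    (hε : 0 < ε) : ∃ s : Finset ℤ, ∀ t, Disjoint t s → ‖∑ k ∈ t, c k • P k x‖ < ε := by
  have hM0 : 0 ≤ M := (norm_nonneg _).trans (hM 0)
  -- Dividing by M + 1 rather than M covers the case M = 0.
  obtain ⟨y, hy, hxy⟩ := hP.dense.exists_dist_lt x (show 0 < ε / (M + 1) by positivity)
  obtain ⟨s, hs⟩ := hP.exists_finset_of_mem_span hy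
  refine ⟨s, fun t ht => ?_⟩
  have h : ∑ k ∈ t, c k • P k x = ∑ k ∈ t, c k • P k (x - y) :=
    Finset.sum_congr rfl fun k hk => by
      rw [map_sub, hs k (Finset.disjoint_left.1 ht hk), sub_zero]
  rw [h]
  refine (hP.norm_sum_le t hM (x - y)).trans_lt ?_
  rw [dist_eq_norm, lt_div_iff₀ (by positivity)] at hxy
  nlinarith [norm_nonneg (x - y)]

lemma summable (hP : IsGrading B P) {c : ℤ → ℂ} {M : ℝ} (hM : ∀ k, ‖c k‖ ≤ M) (x : Y) :
    Summable fun k => c k • P k x := by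
  have := HilbertModule.complete B (X := Y)
  exact summable_iff_vanishing_norm.2 fun ε hε => hP.exists_finset_norm_sum_lt hM x hε

/-- A finite partial sum has norm ‖∑ P_k x‖², so the Cauchy criterion for ∑ P_k x is used with √ε.
-/
lemma summable_inner (hP : IsGrading B P) (x : Y) : Summable fun k => inner B (P k x) (P k x) := by
  refine summable_iff_vanishing_norm.2 fun ε hε => ?_
  obtain ⟨s, hs⟩ := hP.exists_finset_norm_sum_lt (c := fun _ => 1) (fun _ => le_of_eq norm_one) x
    (Real.sqrt_pos.2 hε)
  refine ⟨s, fun t ht => ?_⟩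
  have h := hP.norm_sq_sum t (fun _ => 1) x
  simp only [one_smul, norm_one, one_pow] at h
  rw [← h, ← Real.sq_sqrt hε.le]
  have h1 := hs t ht
  simp only [one_smul] at h1
  gcongr

/-- The operator `∑ c_k P_k`, for bounded `c`. -/
noncomputable def diag (hP : IsGrading B P) (c : ℤ → ℂ) (hc : ∃ M, ∀ k, ‖c k‖ ≤ M) : Y →L[ℂ] Y :=
  LinearMap.mkContinuous
    { toFun := fun x => ∑' k, c k • P k x
      map_add' := fun x y => by
        rw [← (hP.summable hc.choose_spec x).tsum_add (hP.summable hc.choose_spec y)]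
        simp only [map_add, smul_add]
      map_smul' := fun z x => by
        rw [RingHom.id_apply, ← (hP.summable hc.choose_spec x).tsum_const_smul z]
        simp only [map_smul, smul_comm z] } hc.choose
    (fun x => le_of_tendsto (hP.summable hc.choose_spec x).hasSum.norm
      (Filter.Eventually.of_forall fun s => hP.norm_sum_le s hc.choose_spec x))

section Diag

variable {c : ℤ → ℂ} (hc : ∃ M, ∀ k, ‖c k‖ ≤ M)

lemma hasSum_diag (hP : IsGrading B P) (x : Y) : HasSum (fun k => c k • P k x) (hP.diag c hc x) :=
  (hP.summable hc.choose_spec x).hasSum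

lemma norm_diag_le (hP : IsGrading B P) {M : ℝ} (hM : ∀ k, ‖c k‖ ≤ M) : ‖hP.diag c hc‖ ≤ M :=
  ContinuousLinearMap.opNorm_le_bound _ ((norm_nonneg _).trans (hM 0)) fun x =>
    le_of_tendsto (hP.hasSum_diag hc x).norm
      (Filter.Eventually.of_forall fun s => hP.norm_sum_le s hM x)

lemma diag_proj (hP : IsGrading B P) (k : ℤ) (x : Y) : hP.diag c hc (P k x) = c k • P k x := by
  refine (hP.hasSum_diag hc (P k x)).unique ?_
  convert hasSum_single k fun l hl => ?_ using 1
  · rw [hP.proj_self]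
  · rw [hP.proj_of_ne l k hl, smul_zero]

lemma proj_diag (hP : IsGrading B P) (k : ℤ) (x : Y) : P k (hP.diag c hc x) = c k • P k x := by
  have h : hP.proj k ∘L hP.diag c hc = c k • hP.proj k := by
    refine hP.ext_clm fun l z => ?_
    change P k (hP.diag c hc (P l z)) = c k • P k (P l z)
    rw [hP.diag_proj, map_smul]
    by_cases hkl : k = l
    · rw [hkl]
    · rw [hP.proj_of_ne k l hkl, smul_zero, smul_zero]
  exact congrArg (fun T => T x) h

end Diag

/-- The diagonal operator with all coefficients 1 is bounded and agrees with the identity on the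
ranges of the P_k, which span a dense subspace. -/
lemma hasSum_proj (hP : IsGrading B P) (x : Y) : HasSum (fun k => P k x) x := by
  have hc : ∃ M : ℝ, ∀ k : ℤ, ‖(fun _ => (1 : ℂ)) k‖ ≤ M := ⟨1, fun _ => le_of_eq norm_one⟩
  have h : hP.diag (fun _ => 1) hc = ContinuousLinearMap.id ℂ Y :=
    hP.ext_clm fun k x => by rw [hP.diag_proj, one_smul, ContinuousLinearMap.id_apply]
  have h1 := hP.hasSum_diag hc x
  rw [h] at h1
  simpa using h1

lemma ext (hP : IsGrading B P) {x y : Y} (h : ∀ k, P k x = P k y) : x = y :=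
  (hP.hasSum_proj x).unique ((funext h : (fun k => P k x) = fun k => P k y) ▸ hP.hasSum_proj y)

lemma isAdjointPair_diag (hP : IsGrading B P)
    {c : ℤ → ℂ} (hc : ∃ M, ∀ k, ‖c k‖ ≤ M) (hr : ∀ k, star (c k) = c k) :
    IsAdjointPair B (hP.diag c hc) (hP.diag c hc) := fun x y => by
  have h1 : HasSum (fun k => c k • inner B x (P k y)) (inner B x (hP.diag c hc y)) := by
    simpa using (hP.hasSum_diag hc y).mapL (HilbertModule.innerCLM B x)
  have h2 : HasSum (fun k => c k • inner B y (P k x)) (inner B y (hP.diag c hc x)) := by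
    simpa using (hP.hasSum_diag hc x).mapL (HilbertModule.innerCLM B y)
  have h3 := h2.star
  simp only [star_smul, hr, PreHilbertModule.star_inner, hP.inner_proj_left] at h3
  exact h3.unique h1

/-- Truncating c to a finite set of indices changes the diagonal operator by at most the supremum of
the omitted |c_k|, which is small as c tends to 0. The truncated product is a finite combination of
the compact operators T P_k. The identity itself need not be compact on the range of P_k, hence the
factor T. -/
lemma mul_diag_mem_compactEndomorphisms (hP : IsGrading B P) {T : Y →L[ℂ] Y}
    (hT : ∀ k, T * hP.proj k ∈ compactEndomorphisms B Y) {c : ℤ → ℂ}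
    (hc : ∃ M, ∀ k, ‖c k‖ ≤ M) (h0 : Filter.Tendsto c Filter.cofinite (nhds 0)) :
    T * hP.diag c hc ∈ compactEndomorphisms B Y := by
  rw [← SetLike.mem_coe, ← compactEndomorphisms.isClosed.closure_eq, Metric.mem_closure_iff]
  intro ε hε
  have hδ : 0 < ε / (‖T‖ + 1) := by positivity
  have hfin : {k | ¬ ‖c k‖ < ε / (‖T‖ + 1)}.Finite := by
    have := Filter.eventually_cofinite.1 ((Metric.tendsto_nhds.1 h0) _ hδ)
    simpa only [dist_zero_right] using this
  set s := hfin.toFinset with hs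
  refine ⟨∑ k ∈ s, c k • (T * hP.proj k),
    Submodule.sum_mem _ fun k _ => Submodule.smul_mem _ _ (hT k), ?_⟩
  -- The tail of c, bounded by ε/(‖T‖ + 1); its diagonal operator is the error of the truncation.
  set d : ℤ → ℂ := fun k => if k ∈ s then 0 else c k with hd
  have hdb : ∀ k, ‖d k‖ ≤ ε / (‖T‖ + 1) := fun k => by
    by_cases hk : k ∈ s
    · simp only [hd, if_pos hk, norm_zero]
      exact hδ.le
    · simp only [hd, if_neg hk]
      rw [hs, Set.Finite.mem_toFinset, Set.mem_ofPred_eq, not_not] at hk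
      exact hk.le
  have h : T * hP.diag c hc - ∑ k ∈ s, c k • (T * hP.proj k) = T * hP.diag d ⟨_, hdb⟩ := by
    refine hP.ext_clm fun l x => ?_
    simp only [sub_apply, mul_apply_eq_comp, sum_apply, smul_apply, hP.diag_proj, proj_apply]
    by_cases hl : l ∈ s
    · rw [Finset.sum_eq_single l, hP.proj_self]
      · simp [hd, hl]
      · intro k _ hk
        rw [hP.proj_of_ne k l hk, map_zero, smul_zero]
      · exact fun h => (h hl).elim
    · rw [Finset.sum_eq_zero]
      · simp [hd, hl]
      · intro k hk
        rw [hP.proj_of_ne k l (fun h => hl (h ▸ hk)), map_zero, smul_zero]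
  rw [dist_eq_norm, h]
  calc ‖T * hP.diag d ⟨_, hdb⟩‖ ≤ ‖T‖ * (ε / (‖T‖ + 1)) :=
        (norm_mul_le _ _).trans (by gcongr; exact hP.norm_diag_le _ hdb)
    _ < ε := by
      rw [mul_div_assoc', div_lt_iff₀ (by positivity)]
      nlinarith [norm_nonneg T]

end IsGrading

end HilbertModules

/-! ### The functions (1 + k²)^{-1/2} and k(1 + k²)^{-1/2} -/

section BoundedTransform

/-- The function `(1 + k²)^{-1/2}`. -/
noncomputable def invSqrtFun (k : ℤ) : ℝ := (√(1 + (k : ℝ) ^ 2))⁻¹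

/-- The function `k (1 + k²)^{-1/2}`. -/
noncomputable def transformFun (k : ℤ) : ℝ := k * invSqrtFun k

lemma invSqrtFun_pos (k : ℤ) : 0 < invSqrtFun k := inv_pos.2 (Real.sqrt_pos.2 (by positivity))

lemma invSqrtFun_sq (k : ℤ) : invSqrtFun k ^ 2 = (1 + (k : ℝ) ^ 2)⁻¹ := by
  rw [invSqrtFun, inv_pow, Real.sq_sqrt (by positivity)]

lemma one_add_sq_mul_invSqrtFun_sq (k : ℤ) : (1 + (k : ℝ) ^ 2) * invSqrtFun k ^ 2 = 1 := by
  rw [invSqrtFun_sq, mul_inv_cancel₀ (by positivity)]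

lemma invSqrtFun_le_one (k : ℤ) : invSqrtFun k ≤ 1 := by
  have h := one_add_sq_mul_invSqrtFun_sq k
  have h1 := invSqrtFun_pos k
  nlinarith [mul_nonneg (sq_nonneg (k : ℝ)) (sq_nonneg (invSqrtFun k))]

lemma abs_transformFun_le (k : ℤ) : |transformFun k| ≤ 1 := by
  rw [← sq_le_one_iff_abs_le_one, transformFun, mul_pow]
  nlinarith [one_add_sq_mul_invSqrtFun_sq k, sq_nonneg (invSqrtFun k)]

lemma transformFun_sq_sub_one (k : ℤ) : transformFun k ^ 2 - 1 = - invSqrtFun k ^ 2 := by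
  rw [transformFun, mul_pow]
  linarith [one_add_sq_mul_invSqrtFun_sq k]

lemma tendsto_invSqrtFun : Filter.Tendsto invSqrtFun Filter.cofinite (nhds 0) := by
  have h : Filter.Tendsto (fun k : ℤ => |(k : ℝ)|) Filter.cofinite Filter.atTop :=
    tendsto_norm_cocompact_atTop.comp Int.tendsto_coe_cofinite
  refine Filter.Tendsto.inv_tendsto_atTop (Filter.tendsto_atTop_mono (fun k => ?_) h)
  exact Real.abs_le_sqrt (by linarith)

/-- The function `k (1 + k²)^{-1/2}` varies slowly. -/
lemma abs_transformFun_add_sub_le (k n : ℤ) :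
    |transformFun (k + n) - transformFun k| ≤ 2 * |(n : ℝ)| * invSqrtFun k := by
  set a : ℝ := √(1 + ((k + n : ℤ) : ℝ) ^ 2) with ha
  set b : ℝ := √(1 + (k : ℝ) ^ 2) with hb
  have ha0 : 0 < a := Real.sqrt_pos.2 (by positivity)
  have hb0 : 0 < b := Real.sqrt_pos.2 (by positivity)
  have ha2 : a ^ 2 = 1 + ((k : ℝ) + n) ^ 2 := by
    rw [ha, Real.sq_sqrt (by positivity)]
    push_cast
    rfl
  have hb2 : b ^ 2 = 1 + (k : ℝ) ^ 2 := Real.sq_sqrt (by positivity)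
  have hka : |(k : ℝ) + n| ≤ a := abs_le_of_sq_le_sq (by rw [ha2]; linarith) ha0.le
  have hkb : |(k : ℝ)| ≤ b := abs_le_of_sq_le_sq (by rw [hb2]; linarith) hb0.le
  -- The factorisation b² - a² = -n(2k + n) is divided by a + b, which dominates |2k + n|.
  have hba : |b - a| ≤ |(n : ℝ)| := by
    have h1 : (b - a) * (b + a) = -(n * (k + (k + n))) := by nlinarith
    have h2 : |b - a| * (b + a) = |(n : ℝ)| * |(k : ℝ) + (k + n)| := by
      rw [← abs_of_pos (add_pos hb0 ha0), ← abs_mul, h1, abs_neg, abs_mul]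
    have h3 : |(k : ℝ) + (k + n)| ≤ b + a := (abs_add_le _ _).trans (add_le_add hkb hka)
    have h4 : |b - a| * (b + a) ≤ |(n : ℝ)| * (b + a) := by
      rw [h2]
      gcongr
    exact le_of_mul_le_mul_right h4 (add_pos hb0 ha0)
  -- Over the common denominator b the numerator is at most |b - a| + |n| ≤ 2|n|, since |k + n| ≤ a.
  -- This leaves the decaying factor 1/b.
  have h : transformFun (k + n) - transformFun k = (((k : ℝ) + n) / a * (b - a) + n) / b := by
    rw [transformFun, transformFun, invSqrtFun, invSqrtFun, ← ha, ← hb]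
    push_cast
    field_simp
    ring
  rw [h, abs_div, abs_of_pos hb0, invSqrtFun, ← hb, ← div_eq_mul_inv]
  gcongr
  refine (abs_add_le _ _).trans ?_
  rw [abs_mul, abs_div, abs_of_pos ha0]
  have h5 : |(k : ℝ) + n| / a ≤ 1 := (div_le_one ha0).2 hka
  nlinarith [abs_nonneg (b - a), abs_nonneg ((k : ℝ) + n)]

lemma tendsto_transformFun_add_sub (n : ℤ) :
    Filter.Tendsto (fun k => transformFun (k + n) - transformFun k) Filter.cofinite (nhds 0) := by
  refine squeeze_zero_norm (fun k => abs_transformFun_add_sub_le k n) ?_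
  simpa using tendsto_invSqrtFun.const_mul (2 * |(n : ℝ)|)

lemma exists_bound_invSqrtFun : ∃ M : ℝ, ∀ k, ‖((invSqrtFun k : ℝ) : ℂ)‖ ≤ M :=
  ⟨1, fun k => by
    rw [Complex.norm_real, Real.norm_of_nonneg (invSqrtFun_pos k).le]
    exact invSqrtFun_le_one k⟩

lemma exists_bound_transformFun : ∃ M : ℝ, ∀ k, ‖((transformFun k : ℝ) : ℂ)‖ ≤ M :=
  ⟨1, fun k => by
    rw [Complex.norm_real]
    exact abs_transformFun_le k⟩

/-! ### The bounded transform of a diagonal operator -/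

variable {B : Type v} [NonUnitalCStarAlgebra B] {Y : Type w} [NormedAddCommGroup Y]
  [NormedSpace ℂ Y] [HilbertModule B Y]

namespace IsGrading

variable {P : ℤ → Y →ₗ[ℂ] Y}

lemma proj_weightedSum (hP : IsGrading B P) (x : (weightedSum B P hP.orthogonal).domain) (k : ℤ) :
    P k (weightedSum B P hP.orthogonal x) = (k : ℂ) • P k x := by
  have h := (summable_of_mem_weightedDomain hP.orthogonal x.2).hasSum.mapL (hP.proj k)
  refine h.unique ?_
  convert hasSum_single k fun l hl => ?_ using 1
  · rw [map_smul, proj_apply, hP.proj_self]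
  · rw [map_smul, proj_apply, hP.proj_of_ne k l hl.symm, smul_zero]

/-- The series defining the domain is ∑ (y_k|y_k), which converges for every y. Membership in the
domain thus reduces to exhibiting a vector with the components k x_k. -/
lemma mem_domain (hP : IsGrading B P) {x y : Y} (h : ∀ k : ℤ, P k y = (k : ℂ) • P k x) :
    x ∈ (weightedSum B P hP.orthogonal).domain := by
  change Summable _
  convert hP.summable_inner y using 2 with k
  rw [h, PreHilbertModule.inner_smul_left, PreHilbertModule.inner_smul_right, smul_smul,
    ← Complex.coe_smul]
  congr 1
  simp [pow_two]

lemma weightedSum_eq (hP : IsGrading B P) {x y : Y} (h : ∀ k : ℤ, P k y = (k : ℂ) • P k x) :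
    weightedSum B P hP.orthogonal ⟨x, hP.mem_domain h⟩ = y :=
  hP.ext fun k => by rw [hP.proj_weightedSum, h]

lemma weightedSum_spec (hP : IsGrading B P) {x y : Y} (h : ∀ k : ℤ, P k y = (k : ℂ) • P k x) :
    ∃ hx : x ∈ (weightedSum B P hP.orthogonal).domain,
      weightedSum B P hP.orthogonal ⟨x, hx⟩ = y :=
  ⟨hP.mem_domain h, hP.weightedSum_eq h⟩

lemma proj_proj (hP : IsGrading B P)
    (k l : ℤ) (x : Y) : P l (P k x) = if l = k then P k x else 0 := by
  split_ifs with h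
  · rw [h, hP.proj_self]
  · exact hP.proj_of_ne l k h x

lemma isInvSqrtOneAddSq_diag (hP : IsGrading B P) :
    IsInvSqrtOneAddSq B (weightedSum B P hP.orthogonal)
    (hP.diag (fun k => (invSqrtFun k : ℝ)) exists_bound_invSqrtFun) where
  nonneg x := by
    -- Positivity: the operator is the square of the self-adjoint diagonal operator with
    -- coefficients √r(k), so (x|Rx) is of the form (z|z).
    have hc : ∃ M : ℝ, ∀ k, ‖((√(invSqrtFun k) : ℝ) : ℂ)‖ ≤ M := ⟨1, fun k => by
      rw [Complex.norm_real, Real.norm_of_nonneg (Real.sqrt_nonneg _)]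
      exact Real.sqrt_le_one.2 (invSqrtFun_le_one k)⟩
    have h : hP.diag (fun k => (invSqrtFun k : ℝ)) exists_bound_invSqrtFun x
        = hP.diag _ hc (hP.diag _ hc x) := hP.ext fun k => by
      rw [hP.proj_diag, hP.proj_diag, hP.proj_diag, smul_smul, ← Complex.ofReal_mul,
        Real.mul_self_sqrt (invSqrtFun_pos k).le]
    rw [h, ← hP.isAdjointPair_diag hc (fun k => Complex.conj_ofReal _)]
    exact PreHilbertModule.inner_self_nonneg _
  right_inv x := by
    set R := hP.diag (fun k => (invSqrtFun k : ℝ)) exists_bound_invSqrtFun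
    set T := hP.diag (fun k => (transformFun k : ℝ)) exists_bound_transformFun
    -- Since k r(k) = f(k), applying D to R²x gives RTx and applying it once more gives T²x. The
    -- claim then becomes r² + f² = 1 in each component.
    obtain ⟨h1, h1'⟩ := hP.weightedSum_spec (x := R (R x)) (y := R (T x)) fun k => by
      rw [hP.proj_diag, hP.proj_diag, hP.proj_diag, hP.proj_diag, transformFun]
      push_cast
      simp only [smul_smul]
      congr 1
      ring
    obtain ⟨h2, h2'⟩ := hP.weightedSum_spec (x := R (T x)) (y := T (T x)) fun k => by
      rw [hP.proj_diag, hP.proj_diag, hP.proj_diag, hP.proj_diag, transformFun]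
      push_cast
      simp only [smul_smul]
      congr 1
      ring
    refine ⟨h1, h1'.symm ▸ h2, ?_⟩
    simp only [h1', h2']
    refine hP.ext fun k => ?_
    rw [map_add, hP.proj_diag, hP.proj_diag, hP.proj_diag, hP.proj_diag, smul_smul, smul_smul,
      ← add_smul]
    convert one_smul ℂ (P k x) using 2
    have := one_add_sq_mul_invSqrtFun_sq k
    rw [transformFun]
    norm_cast
    linarith
  left_inv x h := hP.ext fun k => by
    rw [hP.proj_diag, hP.proj_diag, map_add, hP.proj_weightedSum, hP.proj_weightedSum, smul_smul,
      smul_smul, smul_add, smul_smul, ← add_smul]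
    convert one_smul ℂ (P k x) using 2
    have := one_add_sq_mul_invSqrtFun_sq k
    norm_cast
    push_cast
    linarith

/-- Uniqueness of the positive square root is checked on each eigenvector y of D, without functional
calculus. For eigenvalue k the left inverse property gives R²y = c²y with c = r(k) > 0. -/
lemma eq_diag_of_isInvSqrtOneAddSq (hP : IsGrading B P) {R : Y →L[ℂ] Y}
    (hR : IsInvSqrtOneAddSq B (weightedSum B P hP.orthogonal) R) :
    R = hP.diag (fun k => (invSqrtFun k : ℝ)) exists_bound_invSqrtFun := by
  let := CStarAlgebra.spectralOrder B
  have := CStarAlgebra.spectralOrderedRing B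
  refine hP.ext_clm fun k x => ?_
  rw [hP.diag_proj]
  set y := P k x with hy
  obtain ⟨h1, h1'⟩ := hP.weightedSum_spec (x := y) (y := (k : ℂ) • y) fun l => by
    rw [map_smul, hy, hP.proj_proj]
    split_ifs with h
    · rw [h]
    · rw [smul_zero, smul_zero]
  have h2 : weightedSum B P hP.orthogonal ⟨y, h1⟩ ∈ (weightedSum B P hP.orthogonal).domain := by
    rw [h1']
    exact Submodule.smul_mem _ _ h1
  have h3 := hR.left_inv ⟨y, h1⟩ h2
  have h4 : weightedSum B P hP.orthogonal ⟨weightedSum B P hP.orthogonal ⟨y, h1⟩, h2⟩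
      = ((k : ℂ) ^ 2) • y := by
    have : (⟨weightedSum B P hP.orthogonal ⟨y, h1⟩, h2⟩ : (weightedSum B P hP.orthogonal).domain)
        = (k : ℂ) • ⟨y, h1⟩ := Subtype.ext h1'
    rw [this, LinearPMap.map_smul, h1', smul_smul, pow_two]
  rw [h4] at h3
  set c : ℝ := invSqrtFun k with hc
  have h5 : R (R y) = ((c : ℂ) ^ 2) • y := by
    have h6 : y + ((k : ℂ) ^ 2) • y = (1 + (k : ℂ) ^ 2) • y := by rw [add_smul, one_smul]
    rw [h6, map_smul, map_smul] at h3
    have h7 : ((c : ℂ) ^ 2) * (1 + (k : ℂ) ^ 2) = 1 := by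
      rw [mul_comm]
      exact_mod_cast one_add_sq_mul_invSqrtFun_sq k
    rw [← one_smul ℂ (R (R y)), ← h7, ← smul_smul, h3]
  -- From (R + c)(R - c)y = 0 one gets Rw = -cw. Positivity of R makes -c(w|w) ≥ 0, which forces
  -- (w|w) = 0.
  set w := R y - (c : ℂ) • y with hw
  have h8 : R w = - ((c : ℂ) • w) := by
    rw [hw, map_sub, map_smul, h5, smul_sub, smul_smul, ← pow_two]
    abel
  obtain ⟨b, hb⟩ := hR.nonneg w
  have h9 : inner B w w = 0 := by
    rw [h8, PreHilbertModule.inner_neg_right, PreHilbertModule.inner_smul_right] at hb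
    have h10 : (0 : B) ≤ (c : ℂ) • inner B w w := by
      rw [Complex.coe_smul]
      exact smul_nonneg (invSqrtFun_pos k).le (PreHilbertModule.inner_self_nonneg' w)
    have h11 : (0 : B) ≤ -((c : ℂ) • inner B w w) := hb ▸ star_mul_self_nonneg b
    have h12 : (c : ℂ) • inner B w w = 0 := le_antisymm (neg_nonneg.1 h11) h10
    exact (smul_eq_zero.1 h12).resolve_left
      (Complex.ofReal_ne_zero.2 (invSqrtFun_pos k).ne')
  exact sub_eq_zero.1 (HilbertModule.eq_zero_of_inner_self h9)

/-- The bounded transform of `∑ k P_k` is `∑ k (1 + k²)^{-1/2} P_k`. -/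
theorem isBoundedTransform_iff (hP : IsGrading B P) {T : Y →L[ℂ] Y} :
    IsBoundedTransform B (weightedSum B P hP.orthogonal) T ↔
      T = hP.diag (fun k => (transformFun k : ℝ)) exists_bound_transformFun := by
  have key (x : Y) := hP.weightedSum_spec
    (x := hP.diag (fun k => (invSqrtFun k : ℝ)) exists_bound_invSqrtFun x)
    (y := hP.diag (fun k => (transformFun k : ℝ)) exists_bound_transformFun x) fun k => by
      rw [hP.proj_diag, hP.proj_diag, smul_smul, transformFun]
      push_cast
      rfl
  constructor
  · rintro ⟨R, hR, h⟩
    obtain rfl := hP.eq_diag_of_isInvSqrtOneAddSq hR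
    ext x
    obtain ⟨h1, h2⟩ := h x
    obtain ⟨h3, h4⟩ := key x
    rw [← h2, ← h4]
  · rintro rfl
    exact ⟨_, hP.isInvSqrtOneAddSq_diag, key⟩

end IsGrading

end BoundedTransform

/-! ### Homogeneous elements and the spectral projections -/

namespace CircleAction

open UniformSpace PreHilbertModule

variable {A : Type v} [NonUnitalCStarAlgebra A] (α : CircleAction A)

/-- The elements `a` of degree `n`, that is, those with `α_z(a) = zⁿ a`. -/
def IsHomogeneous (n : ℤ) (a : A) : Prop := ∀ z : Circle, α.act z a = ((z : ℂ) ^ n) • a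

lemma star_circle_zpow (z : Circle) (n : ℤ) : star ((z : ℂ) ^ n) = (z : ℂ) ^ (-n) := by
  rw [star_zpow₀, zpow_neg, ← inv_zpow]
  congr 1
  exact (Circle.coe_inv_eq_conj z).symm

namespace IsHomogeneous

variable {α}

lemma mul {m n : ℤ} {a b : A} (ha : α.IsHomogeneous m a) (hb : α.IsHomogeneous n b) :
    α.IsHomogeneous (m + n) (a * b) := fun z => by
  rw [map_mul, ha, hb, smul_mul_smul_comm, zpow_add₀ (Circle.coe_ne_zero z)]

lemma star {n : ℤ} {a : A} (ha : α.IsHomogeneous n a) : α.IsHomogeneous (-n) (star a) :=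
  fun z => by rw [map_star, ha, star_smul, star_circle_zpow]

lemma average_zero {a : A} (ha : α.IsHomogeneous 0 a) : α.average a = a := by
  have h : ∀ z, α.act z a = a := fun z => by rw [ha, zpow_zero, one_smul]
  rw [average]
  simp only [h]
  rw [intervalIntegral.integral_const, sub_zero, smul_smul,
    inv_mul_cancel₀ Real.two_pi_pos.ne', one_smul]

lemma average_of_ne {n : ℤ} {a : A} (ha : α.IsHomogeneous n a) (hn : n ≠ 0) :
    α.average a = 0 := by
  have hn' : (n : ℝ) ≠ 0 := by exact_mod_cast hn
  -- At z = e^{iπ/n} one has zⁿ = -1, so invariance of the average under z says that it equals its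
  -- own negative.
  have h := α.average_act (Circle.exp (Real.pi / n)) a
  have h1 : ((Circle.exp (Real.pi / n) : Circle) : ℂ) ^ n = -1 := by
    rw [Circle.coe_exp, ← Complex.exp_int_mul, ← Complex.exp_pi_mul_I]
    congr 1
    rw [← mul_assoc]
    congr 1
    push_cast
    rw [mul_div_cancel₀]
    exact_mod_cast hn
  rw [ha, h1, average_smul, neg_smul, one_smul] at h
  have h4 : (2 : ℂ) • α.average a = 0 := by
    rw [two_smul]
    nth_rewrite 1 [← h]
    exact neg_add_cancel _
  exact (smul_eq_zero.1 h4).resolve_left two_ne_zero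

end IsHomogeneous

lemma unitary_toX (z : Circle) (a : A) : α.unitary z (α.toX a) = α.toX (α.act z a) :=
  complMap_coe _ _

lemma leftMul_toX (a b : A) : α.leftMul a (α.toX b) = α.toX (a * b) :=
  α.complMap_preLeftMul a b

lemma inner_toX (a b : A) : inner α.fixed (α.toX a) (α.toX b) = α.expectation (star a * b) :=
  compl_inner_coe _ _

lemma ract_toX (a : A) (b : α.fixed) : ract (α.toX a) b = α.toX (a * b) :=
  complMap_coe (ractCLM b) _

lemma toX_zero : α.toX 0 = 0 := Completion.coe_zero

lemma norm_leftMul_le (a : A) : ‖α.leftMul a‖ ≤ ‖a‖ := by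
  refine ContinuousLinearMap.opNorm_le_bound _ (norm_nonneg a) fun x => ?_
  refine Completion.induction_on x (isClosed_le (α.leftMul a).continuous.norm
    (continuous_const.mul continuous_norm)) fun b => ?_
  obtain ⟨b, rfl⟩ := Pre.of.surjective b
  change ‖α.leftMul a (α.toX b)‖ ≤ ‖a‖ * ‖α.toX b‖
  rw [leftMul_toX, toX, toX, Completion.norm_coe, Completion.norm_coe]
  exact α.norm_of_mul_le a b

lemma continuous_leftMul : Continuous α.leftMul :=
  AddMonoidHomClass.continuous_of_bound α.leftMul 1 fun a => by
    simpa using α.norm_leftMul_le a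

lemma isAdjointPair_leftMul (a : A) :
    IsAdjointPair α.fixed (α.leftMul a) (α.leftMul (star a)) := fun x y => by
  refine Completion.induction_on₂ x y (isClosed_eq ?_ ?_) fun b c => ?_
  · exact Continuous.compl_inner ((α.leftMul a).continuous.comp continuous_fst) continuous_snd
  · exact Continuous.compl_inner continuous_fst
      ((α.leftMul (star a)).continuous.comp continuous_snd)
  · obtain ⟨b, rfl⟩ := Pre.of.surjective b
    obtain ⟨c, rfl⟩ := Pre.of.surjective c
    change inner α.fixed (α.leftMul a (α.toX b)) (α.toX c)
      = inner α.fixed (α.toX b) (α.leftMul (star a) (α.toX c))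
    rw [leftMul_toX, leftMul_toX, inner_toX, inner_toX, star_mul, mul_assoc]

lemma norm_spectralProj_le (k : ℤ) (x : α.X) : ‖α.spectralProj k x‖ ≤ ‖x‖ := by
  have h : ‖∫ θ in (0 : ℝ)..2 * Real.pi,
      ((Circle.exp θ : ℂ) ^ (-k)) • α.unitary (Circle.exp θ) x‖ ≤ ‖x‖ * |2 * Real.pi - 0| :=
    intervalIntegral.norm_integral_le_of_norm_le_const fun θ _ => by
      rw [norm_smul, norm_zpow, Circle.norm_coe, one_zpow, one_mul, norm_unitary]
  rw [sub_zero, abs_of_pos Real.two_pi_pos] at h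
  rw [spectralProj_apply, norm_smul, norm_inv, Real.norm_of_nonneg Real.two_pi_pos.le,
    inv_mul_le_iff₀ Real.two_pi_pos]
  linarith

lemma spectralProj_eq_self {k : ℤ} {x : α.X} (h : ∀ z, α.unitary z x = ((z : ℂ) ^ k) • x) :
    α.spectralProj k x = x := by
  rw [spectralProj_apply]
  have h1 : ∀ θ : ℝ, ((Circle.exp θ : ℂ) ^ (-k)) • α.unitary (Circle.exp θ) x = x := fun θ => by
    rw [h, smul_smul, ← zpow_add₀ (Circle.coe_ne_zero _), neg_add_cancel, zpow_zero, one_smul]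
  simp only [h1]
  rw [intervalIntegral.integral_const, sub_zero, smul_smul,
    inv_mul_cancel₀ Real.two_pi_pos.ne', one_smul]

/-- No integral has to be evaluated: Φ_k x is some multiple cx of x, while x = Φ_n x is orthogonal
to the range of Φ_k, so (Φ_k x|Φ_k x) = c(Φ_k x|x) = 0. -/
lemma spectralProj_eq_zero {k n : ℤ} (hkn : k ≠ n) {x : α.X}
    (h : ∀ z, α.unitary z x = ((z : ℂ) ^ n) • x) : α.spectralProj k x = 0 := by
  obtain ⟨c, hc⟩ : ∃ c : ℂ, α.spectralProj k x = c • x := by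
    refine ⟨(2 * Real.pi)⁻¹ • ∫ θ in (0 : ℝ)..2 * Real.pi,
      ((Circle.exp θ : ℂ) ^ (-k)) * ((Circle.exp θ : ℂ) ^ n), ?_⟩
    rw [spectralProj_apply, smul_assoc, ← intervalIntegral.integral_smul_const]
    simp only [h, smul_smul]
  refine HilbertModule.eq_zero_of_inner_self (B := α.fixed) ?_
  have h1 := α.inner_spectralProj_of_ne hkn x x
  rw [α.spectralProj_eq_self h] at h1
  nth_rewrite 2 [hc]
  rw [PreHilbertModule.inner_smul_right, h1, smul_zero]

lemma unitary_toX_of_isHomogeneous {n : ℤ} {a : A} (ha : α.IsHomogeneous n a) (z : Circle) :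
    α.unitary z (α.toX a) = ((z : ℂ) ^ n) • α.toX a := by
  rw [unitary_toX, ha, toX_smul]

lemma spectralProj_toX {n : ℤ} {a : A} (ha : α.IsHomogeneous n a) (k : ℤ) :
    α.spectralProj k (α.toX a) = if k = n then α.toX a else 0 := by
  split_ifs with h
  · rw [h]
    exact α.spectralProj_eq_self (α.unitary_toX_of_isHomogeneous ha)
  · exact α.spectralProj_eq_zero h (α.unitary_toX_of_isHomogeneous ha)

/-- The homogeneous elements span a dense subspace. -/
def HasDenseHomogeneous : Prop :=
  Dense (Submodule.span ℂ {a : A | ∃ n, α.IsHomogeneous n a} : Set A)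

/-- The canonical map `A → X` as a bounded linear map. -/
noncomputable def toXCLM : A →L[ℂ] α.X :=
  LinearMap.mkContinuous { toFun := α.toX, map_add' := α.toX_add, map_smul' := α.toX_smul } 1
    (fun a => by simpa using α.norm_toX_le a)

lemma denseRange_toX : DenseRange α.toX := by
  have h : DenseRange ((↑) : Pre α.fixed A → α.X) := Completion.denseRange_coe
  exact h

variable {α}

lemma HasDenseHomogeneous.dense_span (hα : α.HasDenseHomogeneous) :
    Dense (Submodule.span ℂ {x | ∃ n a, α.IsHomogeneous n a ∧ x = α.toX a} : Set α.X) := by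
  refine (α.denseRange_toX.dense_image α.continuous_toX hα).mono ?_
  rintro _ ⟨a, ha, rfl⟩
  have h := Submodule.mem_map_of_mem (f := (α.toXCLM : A →ₗ[ℂ] α.X)) ha
  rw [Submodule.map_span] at h
  refine Submodule.span_mono ?_ h
  rintro _ ⟨b, ⟨n, hb⟩, rfl⟩
  exact ⟨n, b, hb, rfl⟩

lemma HasDenseHomogeneous.ext (hα : α.HasDenseHomogeneous)
    {F : Type*} [NormedAddCommGroup F] [NormedSpace ℂ F]
    {S T : α.X →L[ℂ] F} (h : ∀ n a, α.IsHomogeneous n a → S (α.toX a) = T (α.toX a)) : S = T :=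
  ContinuousLinearMap.ext_on hα.dense_span (by rintro _ ⟨n, a, ha, rfl⟩; exact h n a ha)

theorem HasDenseHomogeneous.isGrading (hα : α.HasDenseHomogeneous) :
    IsGrading α.fixed α.spectralProj where
  orthogonal _ _ h x y := α.inner_spectralProj_of_ne h x y
  proj_self k x := α.spectralProj_eq_self fun z => by
    obtain ⟨t, rfl⟩ : ∃ t, Circle.exp t = z := ⟨Complex.arg z, Circle.exp_arg z⟩
    exact α.unitary_spectralProj k t x
  proj_of_ne k l hkl x := α.spectralProj_eq_zero hkl fun z => by
    obtain ⟨t, rfl⟩ : ∃ t, Circle.exp t = z := ⟨Complex.arg z, Circle.exp_arg z⟩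
    exact α.unitary_spectralProj l t x
  norm_le := α.norm_spectralProj_le
  dense := by
    refine hα.dense_span.mono (Submodule.span_mono ?_)
    rintro _ ⟨n, a, ha, rfl⟩
    exact ⟨n, α.toX a, by rw [α.spectralProj_toX ha, if_pos rfl]⟩

/-- Left multiplication by a raises degrees by n. This shift underlies both the commutator formula
and the induction on k. -/
lemma HasDenseHomogeneous.proj_mul_leftMul (hα : α.HasDenseHomogeneous)
    {n : ℤ} {a : A} (ha : α.IsHomogeneous n a) (k : ℤ) :
    hα.isGrading.proj (k + n) * α.leftMul a = α.leftMul a * hα.isGrading.proj k := by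
  refine hα.ext fun m b hb => ?_
  simp only [mul_apply_eq_comp, IsGrading.proj_apply, leftMul_toX, α.spectralProj_toX hb,
    α.spectralProj_toX (ha.mul hb), add_comm k n, add_right_inj]
  split_ifs
  · rw [leftMul_toX]
  · rw [map_zero]

/-- For c of degree m the element b⋆c has degree m - n, so its average is b⋆c if m = n and 0
otherwise. This is the only source of nonzero compact operators in the argument. -/
lemma HasDenseHomogeneous.rankOne_eq (hα : α.HasDenseHomogeneous)
    {n : ℤ} (a : A) {b : A} (hb : α.IsHomogeneous n b) :
    HilbertModule.rankOne α.fixed (α.toX a) (α.toX b)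
      = α.leftMul (a * star b) * hα.isGrading.proj n := by
  refine hα.ext fun m c hc => ?_
  rw [mul_apply_eq_comp, IsGrading.proj_apply, α.spectralProj_toX hc, HilbertModule.rankOne_apply,
    inner_toX, ract_toX]
  change α.toX (a * α.average (star b * c)) = _
  have h := hb.star.mul hc
  split_ifs with hnm
  · rw [hnm, neg_add_cancel] at h
    rw [h.average_zero, leftMul_toX, mul_assoc]
  · rw [h.average_of_ne (by omega), mul_zero, toX_zero, map_zero]

/-! ### The left ideals of all a with aΦ_k compact -/

/-- The closed left ideal of all `a` for which `a Φ_k` is compact. -/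
noncomputable def HasDenseHomogeneous.compactIdeal (hα : α.HasDenseHomogeneous)
    (k : ℤ) : Submodule ℂ A :=
  (compactEndomorphisms α.fixed α.X).comap
    (LinearMap.mulRight ℂ (hα.isGrading.proj k) ∘ₗ (α.leftMul : A →ₗ[ℂ] (α.X →L[ℂ] α.X)))

lemma HasDenseHomogeneous.isClosed_compactIdeal (hα : α.HasDenseHomogeneous) (k : ℤ) :
    IsClosed (hα.compactIdeal k : Set A) :=
  compactEndomorphisms.isClosed.preimage (α.continuous_leftMul.mul continuous_const)

lemma HasDenseHomogeneous.mul_mem_compactIdeal (hα : α.HasDenseHomogeneous) {k : ℤ} (a : A) {b : A}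
    (hb : b ∈ hα.compactIdeal k) : a * b ∈ hα.compactIdeal k := by
  change α.leftMul (a * b) * hα.isGrading.proj k ∈ compactEndomorphisms α.fixed α.X
  rw [map_mul, mul_assoc]
  exact compactEndomorphisms.mul_mem_left (α.isAdjointPair_leftMul a) hb

/-- Moving Φ_k past c gives abcΦ_k = a(bΦ_{k+n})c, and compact operators absorb adjointable factors
on both sides. This is the induction step that changes the degree. -/
lemma HasDenseHomogeneous.mul_mul_mem_compactIdeal (hα : α.HasDenseHomogeneous)
    {n k : ℤ} (a : A) {b c : A}
    (hc : α.IsHomogeneous n c) (hb : b ∈ hα.compactIdeal (k + n)) :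
    a * b * c ∈ hα.compactIdeal k := by
  rw [mul_assoc]
  refine hα.mul_mem_compactIdeal a ?_
  change α.leftMul (b * c) * hα.isGrading.proj k ∈ compactEndomorphisms α.fixed α.X
  rw [map_mul, mul_assoc, ← hα.proj_mul_leftMul hc k, ← mul_assoc]
  exact compactEndomorphisms.mul_mem_right (α.isAdjointPair_leftMul c) hb

lemma HasDenseHomogeneous.mul_star_mem_compactIdeal (hα : α.HasDenseHomogeneous)
    {n : ℤ} (a : A) {b : A}
    (hb : α.IsHomogeneous n b) : a * star b ∈ hα.compactIdeal n :=
  compactEndomorphisms.rankOne_mem (α.toX a) (α.toX b) fun z =>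
    congrArg (fun T => T z) (hα.rankOne_eq a hb).symm

/-- An element of degree 0 commutes with Φ_k, so the hypothesis makes aΦ_k = Φ_k a vanish. It serves
for the projections at sinks. -/
lemma HasDenseHomogeneous.mem_compactIdeal_of_forall (hα : α.HasDenseHomogeneous) {k : ℤ} {a : A}
    (ha : α.IsHomogeneous 0 a) (h : ∀ b, α.spectralProj k (α.toX (a * b)) = 0) :
    a ∈ hα.compactIdeal k := by
  have h1 := hα.proj_mul_leftMul ha k
  have h2 : hα.isGrading.proj k * α.leftMul a = 0 := α.X_ext fun b => by
    rw [mul_apply_eq_comp, leftMul_toX, IsGrading.proj_apply, h]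
    rfl
  rw [add_zero, h2] at h1
  change α.leftMul a * hα.isGrading.proj k ∈ compactEndomorphisms α.fixed α.X
  rw [← h1]
  exact Submodule.zero_mem _

/-! ### The Kasparov conditions for V -/

/-- The operator `V = ∑ k (1 + k²)^{-1/2} Φ_k`. -/
noncomputable def HasDenseHomogeneous.transform (hα : α.HasDenseHomogeneous) : α.X →L[ℂ] α.X :=
  hα.isGrading.diag (fun k => (transformFun k : ℝ)) exists_bound_transformFun

lemma HasDenseHomogeneous.isBoundedTransform_iff (hα : α.HasDenseHomogeneous) {T : α.X →L[ℂ] α.X} :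
    IsBoundedTransform α.fixed α.generator T ↔ T = hα.transform :=
  hα.isGrading.isBoundedTransform_iff

lemma HasDenseHomogeneous.diag_toX (hα : α.HasDenseHomogeneous)
    {c : ℤ → ℂ} (hc : ∃ M, ∀ k, ‖c k‖ ≤ M) {n : ℤ} {a : A}
    (ha : α.IsHomogeneous n a) : hα.isGrading.diag c hc (α.toX a) = c n • α.toX a := by
  have h := hα.isGrading.diag_proj hc n (α.toX a)
  rwa [α.spectralProj_toX ha, if_pos rfl] at h

theorem HasDenseHomogeneous.isOddKasparovModule_transform (hα : α.HasDenseHomogeneous)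
    (hX : IsCountablyGenerated α.fixed α.X)
    (hc : ∀ a k, a ∈ hα.compactIdeal k) :
    IsOddKasparovModule α.fixed α.leftMul hα.transform where
  countablyGenerated := hX
  isAdjointPair := α.isAdjointPair_leftMul
  exists_adjoint := ⟨_, hα.isGrading.isAdjointPair_diag _ fun _ => Complex.conj_ofReal _⟩
  sub_adjoint S hS a := by
    -- V is its own adjoint and adjoints are unique, so S = V.
    have h := (hα.isGrading.isAdjointPair_diag exists_bound_transformFun
      fun _ => Complex.conj_ofReal _).eq hS
    rw [← h]
    change _ * (hα.transform - hα.transform) ∈ _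
    rw [sub_self, mul_zero]
    exact Submodule.zero_mem _
  sq_sub_one a := by
    have hb : ∃ M : ℝ, ∀ k, ‖((-(invSqrtFun k ^ 2) : ℝ) : ℂ)‖ ≤ M := ⟨1, fun k => by
      rw [Complex.norm_real, norm_neg, Real.norm_of_nonneg (by positivity)]
      exact pow_le_one₀ (invSqrtFun_pos k).le (invSqrtFun_le_one k)⟩
    have h : hα.transform * hα.transform - 1 = hα.isGrading.diag _ hb :=
      hα.isGrading.ext_clm fun k x => by
        simp only [sub_apply, mul_apply_eq_comp, one_apply_eq_self, transform,
          hα.isGrading.diag_proj, map_smul, smul_smul]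
        rw [← transformFun_sq_sub_one]
        push_cast
        rw [sub_smul, one_smul, pow_two]
    rw [h]
    refine hα.isGrading.mul_diag_mem_compactEndomorphisms (hc a) hb ?_
    have h0 := (tendsto_invSqrtFun.pow 2).neg
    rw [zero_pow two_ne_zero, neg_zero] at h0
    exact (Complex.continuous_ofReal.tendsto' 0 0 Complex.ofReal_zero).comp h0
  commutator a := by
    have key : ∀ n a, α.IsHomogeneous n a →
        hα.transform * α.leftMul a - α.leftMul a * hα.transform
          ∈ compactEndomorphisms α.fixed α.X := by
      intro n a ha
      have hb : ∃ M : ℝ, ∀ k, ‖((transformFun (k + n) - transformFun k : ℝ) : ℂ)‖ ≤ M :=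
        ⟨1 + 1, fun k => by
          rw [Complex.norm_real]
          exact (norm_sub_le _ _).trans
            (add_le_add (abs_transformFun_le _) (abs_transformFun_le _))⟩
      -- On b of degree m both sides give (f(m + n) - f(m)) ab.
      have h : hα.transform * α.leftMul a - α.leftMul a * hα.transform
          = α.leftMul a * hα.isGrading.diag _ hb := hα.ext fun m b hb => by
        simp only [sub_apply, mul_apply_eq_comp, transform, leftMul_toX, hα.diag_toX _ hb,
          hα.diag_toX _ (ha.mul hb), map_smul]
        rw [← sub_smul, add_comm n m]
        push_cast
        rfl
      rw [h]
      refine hα.isGrading.mul_diag_mem_compactEndomorphisms (hc a) hb ?_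
      exact (Complex.continuous_ofReal.tendsto' 0 0 Complex.ofReal_zero).comp
        (tendsto_transformFun_add_sub n)
    have hcl : IsClosed {a | hα.transform * α.leftMul a - α.leftMul a * hα.transform
        ∈ compactEndomorphisms α.fixed α.X} :=
      compactEndomorphisms.isClosed.preimage
        ((continuous_const.mul α.continuous_leftMul).sub
          (α.continuous_leftMul.mul continuous_const))
    -- The commutator is linear and norm continuous in a, so homogeneous a suffice.
    refine hcl.closure_subset_iff.2 (fun b hb => ?_) (hα a)
    induction hb using Submodule.span_induction with
    | mem b hb => exact key _ _ hb.choose_spec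
    | zero =>
      change _ ∈ compactEndomorphisms α.fixed α.X
      rw [map_zero, mul_zero, zero_mul, sub_zero]
      exact Submodule.zero_mem _
    | add b c _ _ hb hc =>
      change _ ∈ compactEndomorphisms α.fixed α.X
      rw [map_add, mul_add, add_mul, add_sub_add_comm]
      exact Submodule.add_mem _ hb hc
    | smul z b _ hb =>
      change _ ∈ compactEndomorphisms α.fixed α.X
      rw [map_smul, mul_smul_comm, smul_mul_assoc, ← smul_sub]
      exact Submodule.smul_mem _ z hb

end CircleAction

/-! ### Consequences of the Cuntz–Krieger relations -/

namespace DirectedGraph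

variable {V E : Type u} {G : DirectedGraph V E}

namespace CKFamily

variable {B : Type w} [NonUnitalCStarAlgebra B] (f : G.CKFamily B)

lemma star_p (v : V) : star (f.p v) = f.p v := (f.isStarProjection_p v).isSelfAdjoint.star_eq

lemma p_mul_self (v : V) : f.p v * f.p v = f.p v := (f.isStarProjection_p v).isIdempotentElem

lemma S_mul_p (e : E) : f.S e * f.p (G.r e) = f.S e := by
  rw [← f.star_S_mul_S, ← mul_assoc, f.S_mul_star_mul_S]

/-- Neither relation is an axiom of `CKFamily`; both follow from positivity. With a = S_e - p_{s(e)}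
S_e one has a⋆a = p_{r(e)} - S_e⋆ p_{s(e)} S_e. Expanding p_{s(e)} = ∑ S_{e'} S_{e'}⋆, the term e' =
e contributes p_{r(e)}, so a⋆a plus the sum of all |S_{e'}⋆ S_e|² with e' ≠ e is zero. Each summand
then vanishes. -/
lemma sub_eq_zero_and_star_S_mul_S_eq_zero {e : E} (h : {e' | G.s e' = G.s e}.Finite) :
    f.S e - f.p (G.s e) * f.S e = 0 ∧
      ∀ e', G.s e' = G.s e → e' ≠ e → star (f.S e') * f.S e = 0 := by
  classical
  let := CStarAlgebra.spectralOrder B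
  have := CStarAlgebra.spectralOrderedRing B
  set a := f.S e - f.p (G.s e) * f.S e with ha
  have he : e ∈ h.toFinset := by simp
  have h1 : star (f.S e) * f.p (G.s e) * f.S e = f.p (G.r e) + ∑ e' ∈ h.toFinset.erase e,
      star (star (f.S e') * f.S e) * (star (f.S e') * f.S e) := by
    rw [f.p_eq_sum _ h ⟨e, rfl⟩, Finset.mul_sum, Finset.sum_mul, ← Finset.add_sum_erase _ _ he]
    congr 1
    · rw [← mul_assoc, f.star_S_mul_S, mul_assoc, f.star_S_mul_S, f.p_mul_self]
    · refine Finset.sum_congr rfl fun e' _ => ?_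
      rw [star_mul, star_star]
      simp only [mul_assoc]
  have h2 : star a * a + ∑ e' ∈ h.toFinset.erase e,
      star (star (f.S e') * f.S e) * (star (f.S e') * f.S e) = 0 := by
    have h3 : star a * a = f.p (G.r e) - star (f.S e) * f.p (G.s e) * f.S e := by
      rw [ha, star_sub, star_mul, f.star_p, sub_mul, mul_sub, mul_sub, f.star_S_mul_S,
        mul_assoc (star (f.S e)) (f.p (G.s e)) (f.p (G.s e) * f.S e),
        ← mul_assoc (f.p (G.s e)) (f.p (G.s e)), f.p_mul_self, ← mul_assoc, sub_self, sub_zero]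
    rw [h3, h1]
    abel
  have h4 : ∀ e' ∈ h.toFinset.erase e,
      0 ≤ star (star (f.S e') * f.S e) * (star (f.S e') * f.S e) :=
    fun e' _ => star_mul_self_nonneg _
  rw [add_eq_zero_iff_of_nonneg (star_mul_self_nonneg a) (Finset.sum_nonneg h4),
    Finset.sum_eq_zero_iff_of_nonneg h4] at h2
  refine ⟨CStarRing.star_mul_self_eq_zero_iff a |>.1 h2.1, fun e' hs hne => ?_⟩
  exact CStarRing.star_mul_self_eq_zero_iff _ |>.1
    (h2.2 e' (Finset.mem_erase.2 ⟨hne, by simpa using hs⟩))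

lemma p_mul_S (hG : G.LocallyFinite) (e : E) : f.p (G.s e) * f.S e = f.S e :=
  (sub_eq_zero.1 (f.sub_eq_zero_and_star_S_mul_S_eq_zero (hG (G.s e)).1).1).symm

lemma p_mul_S_of_ne (hG : G.LocallyFinite) {v : V} {e : E} (h : v ≠ G.s e) :
    f.p v * f.S e = 0 := by
  rw [← f.p_mul_S hG, ← mul_assoc, f.p_mul_p _ _ h, zero_mul]

lemma star_S_mul_p (hG : G.LocallyFinite) (e : E) :
    star (f.S e) * f.p (G.s e) = star (f.S e) := by
  rw [← f.star_p, ← star_mul, f.p_mul_S hG]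

lemma star_S_mul_p_of_ne (hG : G.LocallyFinite) {v : V} {e : E} (h : v ≠ G.s e) :
    star (f.S e) * f.p v = 0 := by
  rw [← f.star_p, ← star_mul, f.p_mul_S_of_ne hG h, star_zero]

lemma star_S_mul_S_of_ne (hG : G.LocallyFinite) {e e' : E} (h : e' ≠ e) :
    star (f.S e') * f.S e = 0 := by
  by_cases hs : G.s e' = G.s e
  · exact (f.sub_eq_zero_and_star_S_mul_S_eq_zero (hG (G.s e)).1).2 e' hs h
  · rw [← f.p_mul_S hG e, ← mul_assoc, f.star_S_mul_p_of_ne hG (Ne.symm hs), zero_mul]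

end CKFamily

lemma star_p (v : V) : star (G.p v) = G.p v := G.univFamily.star_p v

lemma p_mul_self (v : V) : G.p v * G.p v = G.p v := G.univFamily.p_mul_self v

lemma p_mul_p {v w : V} (h : v ≠ w) : G.p v * G.p w = 0 := G.univFamily.p_mul_p v w h

lemma S_mul_p (e : E) : G.S e * G.p (G.r e) = G.S e := G.univFamily.S_mul_p e

lemma star_S_mul_S (e : E) : star (G.S e) * G.S e = G.p (G.r e) := G.univFamily.star_S_mul_S e

lemma p_mul_S_of_ne (hG : G.LocallyFinite) {v : V} {e : E} (h : v ≠ G.s e) :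
    G.p v * G.S e = 0 := G.univFamily.p_mul_S_of_ne hG h

lemma star_S_mul_p (hG : G.LocallyFinite) (e : E) : star (G.S e) * G.p (G.s e) = star (G.S e) :=
  G.univFamily.star_S_mul_p hG e

lemma star_S_mul_p_of_ne (hG : G.LocallyFinite) {v : V} {e : E} (h : v ≠ G.s e) :
    star (G.S e) * G.p v = 0 := G.univFamily.star_S_mul_p_of_ne hG h

lemma star_S_mul_S_of_ne (hG : G.LocallyFinite) {e e' : E} (h : e' ≠ e) :
    star (G.S e') * G.S e = 0 := G.univFamily.star_S_mul_S_of_ne hG h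

/-! ### Words in the generators: density, countability and degree -/

variable (G)

/-- The products of generators of `C⋆(G)` and their adjoints. -/
noncomputable def words : Subsemigroup G.Alg :=
  Subsemigroup.closure ((Set.range G.p ∪ Set.range G.S) ∪ star (Set.range G.p ∪ Set.range G.S))

lemma dense_span_words : Dense (Submodule.span ℂ (G.words : Set G.Alg) : Set G.Alg) := by
  intro a
  let T : NonUnitalStarSubalgebra ℂ G.Alg :=
    NonUnitalStarAlgebra.adjoin ℂ (Set.range G.p ∪ Set.range G.S)
  have hT : (T : Set G.Alg) = Submodule.span ℂ (G.words : Set G.Alg) := by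
    rw [words, ← NonUnitalStarAlgebra.adjoin_eq_span]
    rfl
  have hsub : ∀ b ∈ Set.range G.p ∪ Set.range G.S, b ∈ T.topologicalClosure := fun b hb =>
    T.le_topologicalClosure (NonUnitalStarAlgebra.subset_adjoin ℂ _ hb)
  have h : a ∈ T.topologicalClosure := by
    refine G.alg_induction (q := fun a => a ∈ T.topologicalClosure)
      T.isClosed_topologicalClosure (fun v => hsub _ (Or.inl ⟨v, rfl⟩))
      (fun e => hsub _ (Or.inr ⟨e, rfl⟩)) (zero_mem _) (fun a b ha hb => add_mem ha hb)
      (fun a b ha hb => mul_mem ha hb) (fun c a ha => SMulMemClass.smul_mem c ha)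
      (fun a ha => star_mem ha) a
  rw [← hT]
  exact h

/-- The subsemigroup is contained in the image of the free semigroup on s, whose elements are pairs
of a letter and a list of letters. -/
lemma countable_closure_subsemigroup {M : Type*} [Semigroup M] {s : Set M} (hs : s.Countable) :
    (Subsemigroup.closure s : Set M).Countable := by
  have := hs.to_subtype
  have hinj : Function.Injective fun w : FreeSemigroup s => (w.head, w.tail) := by
    rintro ⟨a, l⟩ ⟨b, m⟩ h
    simpa using h
  have : Countable (FreeSemigroup s) := hinj.countable
  have h : Subsemigroup.closure s ≤ (FreeSemigroup.lift (Subtype.val : s → M)).srange := by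
    refine Subsemigroup.closure_le.2 fun a ha => ⟨FreeSemigroup.of ⟨a, ha⟩, ?_⟩
    exact FreeSemigroup.lift_of _ _
  exact (Set.countable_range _).mono h

lemma countable_words [Countable V] [Countable E] : (G.words : Set G.Alg).Countable := by
  have h := (Set.countable_range G.p).union (Set.countable_range G.S)
  refine countable_closure_subsemigroup (h.union ?_)
  rw [← Set.image_star]
  exact h.image _

lemma isHomogeneous_p (v : V) : G.gauge.IsHomogeneous 0 (G.p v) := fun z => by
  rw [zpow_zero, one_smul]
  exact G.gaugeHom_p z v

lemma isHomogeneous_S (e : E) : G.gauge.IsHomogeneous 1 (G.S e) := fun z => by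
  rw [zpow_one]
  exact G.gaugeHom_S z e

lemma hasDenseHomogeneous : G.gauge.HasDenseHomogeneous := by
  refine G.dense_span_words.mono (Submodule.span_mono fun a ha => ?_)
  induction ha using Subsemigroup.closure_induction with
  | mem a ha =>
    rcases ha with (⟨v, rfl⟩ | ⟨e, rfl⟩) | (⟨v, hv⟩ | ⟨e, he⟩)
    · exact ⟨0, G.isHomogeneous_p v⟩
    · exact ⟨1, G.isHomogeneous_S e⟩
    · rw [← star_star a, ← hv]
      exact ⟨_, (G.isHomogeneous_p v).star⟩
    · rw [← star_star a, ← he]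
      exact ⟨_, (G.isHomogeneous_S e).star⟩
  | mul a b _ _ ha hb =>
    obtain ⟨m, hm⟩ := ha
    obtain ⟨n, hn⟩ := hb
    exact ⟨m + n, hm.mul hn⟩

/-- The images of the countably many words already span a dense subspace over ℂ, so the right action
is not needed. -/
lemma isCountablyGenerated_X [Countable V] [Countable E] :
    IsCountablyGenerated G.gauge.fixed G.gauge.X := by
  refine ⟨G.gauge.toX '' G.words, G.countable_words.image _, ?_⟩
  refine (G.gauge.denseRange_toX.dense_image G.gauge.continuous_toX G.dense_span_words).mono ?_
  rintro _ ⟨a, ha, rfl⟩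
  have h := Submodule.mem_map_of_mem (f := (G.gauge.toXCLM : G.Alg →ₗ[ℂ] G.gauge.X)) ha
  rw [Submodule.map_span] at h
  exact Submodule.span_mono Set.subset_union_left h

/-! ### Sinks -/

/-- The products `p_v S_{e₁}⋆ ⋯ S_{eₙ}⋆`. -/
inductive IsBackwardWord (v : V) : G.Alg → Prop
  | base : IsBackwardWord v (G.p v)
  | mul_star (x : G.Alg) (e : E) (hx : IsBackwardWord v x) :
      IsBackwardWord v (x * star (G.S e))

/-- The closed linear span of the products `p_v S_{e₁}⋆ ⋯ S_{eₙ}⋆`. -/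
noncomputable def backwardSpan (v : V) : Submodule ℂ G.Alg :=
  (Submodule.span ℂ {x | G.IsBackwardWord v x}).topologicalClosure

variable {G}

lemma IsBackwardWord.mem {v : V} {x : G.Alg} (hx : G.IsBackwardWord v x) :
    x ∈ G.backwardSpan v :=
  Submodule.le_topologicalClosure _ (Submodule.subset_span hx)

lemma IsBackwardWord.exists_isHomogeneous {v : V} {x : G.Alg} (hx : G.IsBackwardWord v x) :
    ∃ n ≤ 0, G.gauge.IsHomogeneous n x := by
  induction hx with
  | base => exact ⟨0, le_rfl, G.isHomogeneous_p v⟩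
  | mul_star x e _ ih =>
    obtain ⟨n, hn, hx⟩ := ih
    exact ⟨_, by omega, hx.mul (G.isHomogeneous_S e).star⟩

lemma IsBackwardWord.mul_p_mem (hG : G.LocallyFinite) {v : V} {x : G.Alg}
    (hx : G.IsBackwardWord v x) (w : V) : x * G.p w ∈ G.backwardSpan v := by
  have h0 : (0 : G.Alg) ∈ G.backwardSpan v := Submodule.zero_mem _
  cases hx with
  | base =>
    by_cases h : v = w
    · rw [← h, p_mul_self]
      exact IsBackwardWord.base.mem
    · rwa [p_mul_p h]
  | mul_star x e hx =>
    rw [mul_assoc]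
    by_cases h : w = G.s e
    · rw [h, star_S_mul_p hG]
      exact (hx.mul_star x e).mem
    · rwa [star_S_mul_p_of_ne hG h, mul_zero]

/-- A factor S_e can only cancel: against a last letter S_{e'}⋆ it gives 0 or p_{r(e)}, and against
p_v alone it gives 0 because v emits nothing. Hence the degree never becomes positive. -/
lemma IsBackwardWord.mul_S_mem (hG : G.LocallyFinite) {v : V} (hv : ∀ e, G.s e ≠ v)
    {x : G.Alg} (hx : G.IsBackwardWord v x) (e : E) : x * G.S e ∈ G.backwardSpan v := by
  have h0 : (0 : G.Alg) ∈ G.backwardSpan v := Submodule.zero_mem _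
  cases hx with
  | base => rwa [p_mul_S_of_ne hG (hv e).symm]
  | mul_star x e' hx =>
    rw [mul_assoc]
    by_cases h : e' = e
    · rw [h, star_S_mul_S]
      exact hx.mul_p_mem hG _
    · rwa [star_S_mul_S_of_ne hG h, mul_zero]

lemma mul_mem_backwardSpan_of_forall {v : V} {a : G.Alg}
    (h : ∀ x, G.IsBackwardWord v x → x * a ∈ G.backwardSpan v) {x : G.Alg}
    (hx : x ∈ G.backwardSpan v) : x * a ∈ G.backwardSpan v := by
  have h1 : G.backwardSpan v ≤ (G.backwardSpan v).comap (LinearMap.mulRight ℂ a) :=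
    Submodule.topologicalClosure_minimal _ (Submodule.span_le.2 h)
      ((Submodule.isClosed_topologicalClosure _).preimage (continuous_id.mul continuous_const))
  exact h1 hx

/-- For a sink `v` the products `p_v S_{e₁}⋆ ⋯ S_{eₙ}⋆` span a dense subspace of `p_v C⋆(G)`. -/
lemma mul_mem_backwardSpan (hG : G.LocallyFinite) {v : V} (hv : ∀ e, G.s e ≠ v) (a : G.Alg) :
    ∀ x ∈ G.backwardSpan v, x * a ∈ G.backwardSpan v := by
  have hcl : IsClosed (G.backwardSpan v : Set G.Alg) := Submodule.isClosed_topologicalClosure _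
  -- The induction principle asks for closure under adjoints, so the statement is carried for a and
  -- a⋆ together.
  refine (G.alg_induction (q := fun a => (∀ x ∈ G.backwardSpan v, x * a ∈ G.backwardSpan v) ∧
    ∀ x ∈ G.backwardSpan v, x * star a ∈ G.backwardSpan v) ?_ (fun w => ?_) (fun e => ?_)
    ?_ ?_ ?_ ?_ ?_ a).1
  · simp only [Set.ofPred_and, Set.ofPred_forall]
    refine IsClosed.inter ?_ ?_
    · exact isClosed_iInter fun x => isClosed_iInter fun _ =>
        hcl.preimage (continuous_const.mul continuous_id)
    · exact isClosed_iInter fun x => isClosed_iInter fun _ =>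
        hcl.preimage (continuous_const.mul continuous_star)
  · have h : ∀ x ∈ G.backwardSpan v, x * G.p w ∈ G.backwardSpan v := fun x hx =>
      mul_mem_backwardSpan_of_forall (fun y hy => hy.mul_p_mem hG w) hx
    refine ⟨h, ?_⟩
    rwa [star_p]
  · exact ⟨fun x hx => mul_mem_backwardSpan_of_forall (fun y hy => hy.mul_S_mem hG hv e) hx,
      fun x hx => mul_mem_backwardSpan_of_forall (fun y hy => (hy.mul_star y e).mem) hx⟩
  · simp only [star_zero, mul_zero]
    exact ⟨fun _ _ => Submodule.zero_mem _, fun _ _ => Submodule.zero_mem _⟩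
  · rintro b c ⟨hb, hb'⟩ ⟨hc, hc'⟩
    simp only [star_add, mul_add]
    exact ⟨fun x hx => Submodule.add_mem _ (hb x hx) (hc x hx),
      fun x hx => Submodule.add_mem _ (hb' x hx) (hc' x hx)⟩
  · rintro b c ⟨hb, hb'⟩ ⟨hc, hc'⟩
    simp only [star_mul, ← mul_assoc]
    exact ⟨fun x hx => hc _ (hb x hx), fun x hx => hb' _ (hc' x hx)⟩
  · rintro z b ⟨hb, hb'⟩
    simp only [star_smul, mul_smul_comm]
    exact ⟨fun x hx => Submodule.smul_mem _ _ (hb x hx),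
      fun x hx => Submodule.smul_mem _ _ (hb' x hx)⟩
  · rintro b ⟨hb, hb'⟩
    rw [star_star]
    exact ⟨hb', hb⟩

lemma spectralProj_toX_of_mem_backwardSpan {v : V} {k : ℤ} (hk : 0 < k) {x : G.Alg}
    (hx : x ∈ G.backwardSpan v) : G.gauge.spectralProj k (G.gauge.toX x) = 0 := by
  let T := G.hasDenseHomogeneous.isGrading.proj k ∘L G.gauge.toXCLM
  have h : G.backwardSpan v ≤ LinearMap.ker (T : G.Alg →ₗ[ℂ] G.gauge.X) := by
    refine Submodule.topologicalClosure_minimal _ (Submodule.span_le.2 fun y hy => ?_) ?_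
    · obtain ⟨n, hn, hy⟩ := IsBackwardWord.exists_isHomogeneous hy
      change G.gauge.spectralProj k (G.gauge.toX y) = 0
      rw [G.gauge.spectralProj_toX hy, if_neg (by omega)]
    · exact isClosed_singleton.preimage T.continuous
  exact h hx

/-- All of p_v A lies in the closed span of elements of degree ≤ 0, so Φ_k kills it for k > 0 and
p_v Φ_k is 0. -/
lemma p_mem_compactIdeal_of_sink (hG : G.LocallyFinite) {v : V} (hv : ∀ e, G.s e ≠ v) {k : ℤ}
    (hk : 0 < k) : G.p v ∈ G.hasDenseHomogeneous.compactIdeal k :=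
  G.hasDenseHomogeneous.mem_compactIdeal_of_forall (G.isHomogeneous_p v) fun a =>
    spectralProj_toX_of_mem_backwardSpan hk
      (mul_mem_backwardSpan hG hv a _ IsBackwardWord.base.mem)

/-! ### Compactness of aΦ_k for all a and k -/

lemma p_mem_compactIdeal_zero (v : V) : G.p v ∈ G.hasDenseHomogeneous.compactIdeal 0 := by
  have h := G.hasDenseHomogeneous.mul_star_mem_compactIdeal (G.p v) (G.isHomogeneous_p v)
  rwa [star_p, p_mul_self] at h

/-- The induction runs over all vertices at once, since the step passes from v to the ranges of its
edges: p_v Φ_{k+1} = ∑ S_e (p_{r(e)} Φ_k) S_e⋆. The sum is finite by local finiteness, and sinks are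
treated separately. -/
lemma p_mem_compactIdeal_natCast (hG : G.LocallyFinite) (k : ℕ) : ∀ v : V,
    G.p v ∈ G.hasDenseHomogeneous.compactIdeal k := by
  induction k with
  | zero => exact p_mem_compactIdeal_zero
  | succ k ih =>
    intro v
    by_cases hv : ∃ e, G.s e = v
    · have h : G.p v = ∑ e ∈ (hG v).1.toFinset, G.S e * star (G.S e) :=
        G.univFamily.p_eq_sum v (hG v).1 hv
      rw [h]
      refine Submodule.sum_mem _ fun e _ => ?_
      have h1 : G.S e * star (G.S e) = G.S e * G.p (G.r e) * star (G.S e) := by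
        rw [S_mul_p]
      rw [h1]
      refine G.hasDenseHomogeneous.mul_mul_mem_compactIdeal _ (G.isHomogeneous_S e).star ?_
      convert ih (G.r e) using 2
      push_cast
      ring
    · push Not at hv
      exact p_mem_compactIdeal_of_sink hG hv (by positivity)

/-- Here the step goes backwards along one edge e with range v: p_v Φ_{-k-1} = S_e⋆ (p_{s(e)}
Φ_{-k}) S_e. Such an edge exists because there are no sources. -/
lemma p_mem_compactIdeal_neg_natCast (hG : G.LocallyFinite) (hs : G.NoSources) (k : ℕ) : ∀ v : V,
    G.p v ∈ G.hasDenseHomogeneous.compactIdeal (-k) := by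
  induction k with
  | zero =>
    rw [Nat.cast_zero, neg_zero]
    exact p_mem_compactIdeal_zero
  | succ k ih =>
    intro v
    obtain ⟨e, rfl⟩ := hs v
    have h1 : G.p (G.r e) = star (G.S e) * G.p (G.s e) * G.S e := by
      rw [star_S_mul_p hG, star_S_mul_S]
    rw [h1]
    refine G.hasDenseHomogeneous.mul_mul_mem_compactIdeal _ (G.isHomogeneous_S e) ?_
    convert ih (G.s e) using 2
    push_cast
    ring

lemma p_mem_compactIdeal (hG : G.LocallyFinite) (hs : G.NoSources) (v : V) (k : ℤ) :
    G.p v ∈ G.hasDenseHomogeneous.compactIdeal k := by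
  obtain ⟨n, rfl | rfl⟩ := k.eq_nat_or_neg
  · exact p_mem_compactIdeal_natCast hG n v
  · exact p_mem_compactIdeal_neg_natCast hG hs n v

theorem mem_compactIdeal (hG : G.LocallyFinite) (hs : G.NoSources) (a : G.Alg) (k : ℤ) :
    a ∈ G.hasDenseHomogeneous.compactIdeal k := by
  set I := G.hasDenseHomogeneous.compactIdeal k
  have hp : ∀ v, G.p v ∈ I := fun v => p_mem_compactIdeal hG hs v k
  have hideal : ∀ a b : G.Alg, b ∈ I → a * b ∈ I := fun a b hb =>
    G.hasDenseHomogeneous.mul_mem_compactIdeal a hb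
  have hcl : IsClosed (I : Set G.Alg) := G.hasDenseHomogeneous.isClosed_compactIdeal k
  -- I is only known to be a left ideal, so closure under adjoints is built into the statement. For
  -- a product, bc uses c ∈ I and (bc)⋆ = c⋆b⋆ uses b⋆ ∈ I.
  refine (G.alg_induction (q := fun a => a ∈ I ∧ star a ∈ I) ?_ (fun v => ?_) (fun e => ?_)
    ?_ ?_ ?_ ?_ ?_ a).1
  · exact hcl.inter (hcl.preimage continuous_star)
  · rw [star_p]
    exact ⟨hp v, hp v⟩
  · constructor
    · rw [← S_mul_p e]
      exact hideal _ _ (hp _)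
    · rw [← star_S_mul_p hG e]
      exact hideal _ _ (hp _)
  · rw [star_zero]
    exact ⟨I.zero_mem, I.zero_mem⟩
  · rintro b c ⟨hb, hb'⟩ ⟨hc, hc'⟩
    rw [star_add]
    exact ⟨I.add_mem hb hc, I.add_mem hb' hc'⟩
  · rintro b c ⟨hb, hb'⟩ ⟨hc, hc'⟩
    rw [star_mul]
    exact ⟨hideal _ _ hc, hideal _ _ hb'⟩
  · rintro z b ⟨hb, hb'⟩
    rw [star_smul]
    exact ⟨I.smul_mem _ hb, I.smul_mem _ hb'⟩
  · rintro b ⟨hb, hb'⟩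
    rw [star_star]
    exact ⟨hb', hb⟩

end DirectedGraph

end GraphKK

/-! ### The main theorem -/

theorem theorem4p6 {V E : Type u} [Countable V] [Countable E] (G : GraphKK.DirectedGraph V E)
    (hG : G.LocallyFinite) (hs : G.NoSources) :
    (∃! T : G.gauge.X →L[ℂ] G.gauge.X,
      GraphKK.IsBoundedTransform G.gauge.fixed G.gauge.generator T) ∧
    ∀ T : G.gauge.X →L[ℂ] G.gauge.X,
      GraphKK.IsBoundedTransform G.gauge.fixed G.gauge.generator T →
        ∃ h : GraphKK.IsOddKasparovModule G.gauge.fixed G.gauge.leftMul T,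
          ∃ κ : GraphKK.KK1 G.Alg G.gauge.fixed,
            κ = GraphKK.KK1.classOf G.gauge.leftMul T h := by
  have hα := G.hasDenseHomogeneous
  refine ⟨⟨hα.transform, hα.isBoundedTransform_iff.2 rfl,
    fun T hT => hα.isBoundedTransform_iff.1 hT⟩, fun T hT => ?_⟩
  obtain rfl := hα.isBoundedTransform_iff.1 hT
  exact ⟨hα.isOddKasparovModule_transform G.isCountablyGenerated_X
    (GraphKK.DirectedGraph.mem_compactIdeal hG hs), _, rfl⟩
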